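/- Let $Q$ be a finite-dimensional smooth manifold with a smooth pseudo-Riemannian metric $g$ (a symmetric, non-singular type $(0,2)$ tensor field), $J$ a smooth type $(1,1)$ tensor field on $Q$, and $f\in C^\infty(Q)$; $f$ is also regarded as a function on $TQ$. On $TQ$, with induced coordinates $(q^i,u^i)$, let $L=\tfrac12 g(u,u)$, let $S=\partial/\partial u^i\otimes dq^i$ be the vertical endomorphism, $\Delta=u^i\partial/\partial u^i$, $\theta_L=S(dL)=dL\circ S$, $\omega_L=d\theta_L$, and $E_L=\Delta(L)-L$. For a function $F$ on $TQ$ let $\xi_F$ be the vector field with $i_{\xi_F}\omega_L=-dF$, and put $\Gamma=\xi_{E_L}$. Let $J^c$ be the complete lift of $J$ to $TQ$ and $R$ the type $(1,1)$ tensor field on $TQ$ defined by $i_{R\xi}\omega_L=i_\xi\, d(dL\circ J^c\circ S)$ for all $\xi$. Write $X^V$ for the vertical lift, and $X^H=X^i(\partial/\partial q^i-\Gamma^k_i\,\partial/\partial u^k)$ for the horizontal lift, of vector fields $X$ along the projection $\tau:TQ\to Q$, where $\Gamma=u^i\partial/\partial q^i+F^i\partial/\partial u^i$ and $\Gamma^i_j=-\tfrac12\,\partial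 F^i/\partial u^j$. The dynamical covariant derivative $\nabla$ and the Jacobi endomorphism $\Phi$ are defined by $[\Gamma,X^V]=-X^H+(\nabla X)^V$ and $[\Gamma,X^H]=(\nabla X)^H+\Phi(X)^V$; $\nabla$ acts as $\Gamma$ on functions and is extended to tensor fields along $\tau$ as a derivation. Let $T=u^i\partial/\partial q^i$ be the canonical vector field along $\tau$, let $\theta_L(X)=dL(X^V)$ also denote the corresponding 1-form along $\tau$, let $d^Hf(X)=X^H(f)$, and let $X_f$ be defined by $g(X_f,Y)=-d^Hf(Y)$. Let $D^H_XY$ be the vertical component of $[X^H,Y^V]$ for $Y$ along $\tau$; with $(D^H_X\alpha)(Y)=X^H(\alpha(Y))-\alpha(D^H_XY)$ and $d^H\alpha(X,Y)=(D^H_X\alpha)(Y)-(D^H_Y\alpha)(X)$ for 1-forms $\alpha$ along $\tau$, let the tensor field $U$ along $\tau$ be defined by $g(UX,Y)=d^H(\theta_L\circ J)(X,Y)$. **Theorem 1.** The following are equivalent: (a) $\mathcal L_\Gamma R=\Gamma\otimes df-\xi_f\otimes dE_L$ on $TQ$; (b) $J$ is $g$-symmetric, i.e. $g(JX,Y)=g(X,JY)$,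 and $\nabla J=\tfrac12\,(T\otimes d^Hf-X_f\otimes\theta_L)$; (c) $J$ is a special conformal Killing tensor with function $f$: it is $g$-symmetric and $J_{lj|k}=\tfrac12\left(g_{lk}\,\frac{\partial f}{\partial q^j}+g_{jk}\,\frac{\partial f}{\partial q^l}\right)$, where $J_{lj}=g_{lm}J^m_j$ and the bar denotes the Levi-Civita covariant derivative. If these conditions hold, then moreover $$U=-\tfrac12\,(T\otimes d^Hf+X_f\otimes\theta_L),\qquad \Phi J-J\Phi=\tfrac12\,(T\otimes\nabla d^Hf+\nabla X_f\otimes\theta_L),\qquad R=J^c-\Delta\otimes df .$$ -/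

import Mathlib

open scoped Manifold ContDiff

noncomputable section

namespace TangentGeometry

/-!
### Calculus on a coordinate domain

In this part `E` is a vector space containing a coordinate domain of the base manifold `Q`; the
induced coordinate domain of `TQ` lies in `E × E`, with points `p = (q, u)`, and a tangent vector
of `TQ` is a pair `(a, b)`, meaning `aⁱ ∂/∂qⁱ + bⁱ ∂/∂uⁱ`. Every definition below is the usual
coordinate-free one, read on such a domain; all derivatives at a point only depend on the
germs of the data at that point. Vectors `X : E` are identified with the fields having constant
components in the coordinates.
-/

/-- The exterior derivative of a 1-form `α` on a vector space, `dα(ξ, η) = ξ(α η) - η(α ξ)` for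
constant `ξ, η`, as the map `ξ ↦ i_ξ dα`. -/
def extD {V : Type*} [NormedAddCommGroup V] [NormedSpace ℝ V] (α : V → V →L[ℝ] ℝ) (p : V) :
    V →L[ℝ] V →L[ℝ] ℝ :=
  fderiv ℝ α p - (fderiv ℝ α p).flip

/-- The vector `ξ` with `B(ξ, ·) = α`, for a non-degenerate bilinear form `B`. -/
def sharp {V : Type*} [NormedAddCommGroup V] [NormedSpace ℝ V] (B : V →L[ℝ] V →L[ℝ] ℝ)
    (α : V →L[ℝ] ℝ) : V :=
  B.inverse α

variable {E : Type*} [NormedAddCommGroup E] [NormedSpace ℝ E]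

/-- The vertical lift of vectors, `X ↦ Xⱽ = (0, X)`. -/
def vLift : E →L[ℝ] E × E := ContinuousLinearMap.inr ℝ E E

/-- The vertical endomorphism `S = ∂/∂uⁱ ⊗ dqⁱ`. -/
def vertEndo : E × E →L[ℝ] E × E := vLift.comp (ContinuousLinearMap.fst ℝ E E)

/-- The Liouville vector field `Δ = uⁱ ∂/∂uⁱ`. -/
def liouville (p : E × E) : E × E := (0, p.2)

/-- The canonical vector field `T = uⁱ ∂/∂qⁱ` along the projection `TQ → Q`. -/
def totalT (p : E × E) : E := p.2

/-- The kinetic energy Lagrangian `L = ½ g(u, u)`. -/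
def kinetic (g : E → E →L[ℝ] E →L[ℝ] ℝ) (p : E × E) : ℝ := (1 / 2) * g p.1 p.2 p.2

/-- The Poincaré-Cartan 1-form `θ_L = S(dL)` on `TQ`. -/
def thetaForm (L : E × E → ℝ) (p : E × E) : E × E →L[ℝ] ℝ := (fderiv ℝ L p).comp vertEndo

/-- The semi-basic 1-form `θ_L`, regarded as a 1-form along the projection:
`θ_L(X) = dL(Xⱽ)`. -/
def theta (L : E × E → ℝ) (p : E × E) : E →L[ℝ] ℝ := (fderiv ℝ L p).comp vLift

/-- The Poincaré-Cartan 2-form `ω_L = dθ_L`. -/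
def omega (L : E × E → ℝ) : E × E → E × E →L[ℝ] E × E →L[ℝ] ℝ := extD (thetaForm L)

/-- The energy `E_L = Δ(L) - L`. -/
def energy (L : E × E → ℝ) (p : E × E) : ℝ := fderiv ℝ L p (liouville p) - L p

/-- The Hamiltonian vector field `ξ_F` of a function `F` on `TQ`: `i_{ξ_F} ω_L = -dF`. -/
def hamField (L F : E × E → ℝ) (p : E × E) : E × E := sharp (omega L p) (-fderiv ℝ F p)

/-- The Euler-Lagrange field `Γ` of `L`: `i_Γ ω_L = -dE_L`. -/
def lagrangeField (L : E × E → ℝ) : E × E → E × E := hamField L (energy L)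

/-- The complete lift
`Jᶜ = Jⁱⱼ (∂/∂qⁱ ⊗ dqʲ + ∂/∂uⁱ ⊗ duʲ) + uᵏ (∂Jⁱⱼ/∂qᵏ) ∂/∂uⁱ ⊗ dqʲ`
of a type (1,1) tensor field `J` on the base. -/
def completeLift (J : E → E →L[ℝ] E) (p : E × E) : E × E →L[ℝ] E × E :=
  ((J p.1).comp (ContinuousLinearMap.fst ℝ E E)).prod
    ((J p.1).comp (ContinuousLinearMap.snd ℝ E E) +
      (fderiv ℝ J p.1 p.2).comp (ContinuousLinearMap.fst ℝ E E))

/-- The 2-form `ω₁ = d d_{JᶜS} L = d(dL ∘ Jᶜ ∘ S)`. -/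
def omegaOne (L : E × E → ℝ) (J : E → E →L[ℝ] E) : E × E → E × E →L[ℝ] E × E →L[ℝ] ℝ :=
  extD fun p => (fderiv ℝ L p).comp ((completeLift J p).comp vertEndo)

/-- The type (1,1) tensor field `R` on `TQ` with `i_{R ξ} ω_L = i_ξ ω₁` for all `ξ`. -/
def recursionTensor (L : E × E → ℝ) (J : E → E →L[ℝ] E) (p : E × E) : E × E →L[ℝ] E × E :=
  (omega L p).inverse.comp (omegaOne L J p)

/-- The Lie derivative of a type (1,1) tensor field:
`(𝓛_Γ R)(ξ) = [Γ, R ξ] - R [Γ, ξ]`. -/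
def lieDerivTensor {V : Type*} [NormedAddCommGroup V] [NormedSpace ℝ V] (Γ : V → V)
    (R : V → V →L[ℝ] V) (p : V) (ξ : V) : V :=
  VectorField.lieBracket ℝ Γ (fun p' => R p' ξ) p -
    R p (VectorField.lieBracket ℝ Γ (fun _ => ξ) p)

/-- The coefficients `Γⁱⱼ = -½ ∂Fⁱ/∂uʲ` of the non-linear connection of a second-order field
`Γ = uⁱ ∂/∂qⁱ + Fⁱ ∂/∂uⁱ`. -/
def connection (Γ : E × E → E × E) (p : E × E) : E →L[ℝ] E :=
  -((1 / 2 : ℝ) • ((ContinuousLinearMap.snd ℝ E E).comp ((fderiv ℝ Γ p).comp vLift)))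

/-- The horizontal lift `X ↦ Xᴴ = Xⁱ (∂/∂qⁱ - Γᵏᵢ ∂/∂uᵏ)`. -/
def hLift (Γ : E × E → E × E) (p : E × E) : E →L[ℝ] E × E :=
  (ContinuousLinearMap.id ℝ E).prod (-connection Γ p)

/-- The vertical component `Y` in the decomposition `ξ = Xᴴ + Yⱽ`. -/
def vertPart (Γ : E × E → E × E) (p : E × E) (ξ : E × E) : E := ξ.2 + connection Γ p ξ.1

/-- The dynamical covariant derivative `∇X` of a vector field along the projection: the vertical
component of `[Γ, Xⱽ] = -Xᴴ + (∇X)ⱽ`. -/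
def dynCov (Γ : E × E → E × E) (X : E × E → E) (p : E × E) : E :=
  vertPart Γ p (VectorField.lieBracket ℝ Γ (fun p' => vLift (X p')) p)

/-- The dynamical covariant derivative of a 1-form along the projection:
`(∇α)(X) = Γ(α X) - α(∇X)`. -/
def dynCovForm (Γ : E × E → E × E) (α : E × E → E →L[ℝ] ℝ) (p : E × E) (X : E) : ℝ :=
  fderiv ℝ (fun p' => α p' X) p (Γ p) - α p (dynCov Γ (fun _ => X) p)

/-- The dynamical covariant derivative of a type (1,1) tensor field along the projection:
`(∇W)(X) = ∇(W X) - W(∇X)`. -/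
def dynCovTensor (Γ : E × E → E × E) (W : E × E → E →L[ℝ] E) (p : E × E) (X : E) : E :=
  dynCov Γ (fun p' => W p' X) p - W p (dynCov Γ (fun _ => X) p)

/-- The Jacobi endomorphism `Φ`: the vertical component of `[Γ, Xᴴ] = (∇X)ᴴ + Φ(X)ⱽ`. -/
def jacobiEndo (Γ : E × E → E × E) (p : E × E) (X : E) : E :=
  vertPart Γ p (VectorField.lieBracket ℝ Γ (fun p' => hLift Γ p' X) p)

/-- The horizontal differential of a function `f` on the base: `dᴴf(X) = Xᴴ(f)`. -/
def dH (Γ : E × E → E × E) (f : E → ℝ) (p : E × E) : E →L[ℝ] ℝ :=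
  (fderiv ℝ (fun p' : E × E => f p'.1) p).comp (hLift Γ p)

/-- The horizontal covariant derivative of constant fields, `X ↦ (Y ↦ Dᴴ_X Y)`: the vertical
component of `[Xᴴ, Yⱽ]`, in coordinates `Xᵏ Yʲ ∂Γⁱₖ/∂uʲ`. -/
def horCovConst (Γ : E × E → E × E) (p : E × E) : E →L[ℝ] E →L[ℝ] E :=
  ((fderiv ℝ (connection Γ) p).comp vLift).flip

/-- The horizontal covariant derivative of a 1-form along the projection:
`(Dᴴ_X α)(Y) = Xᴴ(α Y) - α(Dᴴ_X Y)`. -/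
def horCovForm (Γ : E × E → E × E) (α : E × E → E →L[ℝ] ℝ) (p : E × E) :
    E →L[ℝ] E →L[ℝ] ℝ :=
  (fderiv ℝ α p).comp (hLift Γ p) -
    (ContinuousLinearMap.compL ℝ E E ℝ (α p)).comp (horCovConst Γ p)

/-- The horizontal exterior derivative of a 1-form along the projection:
`dᴴα(X, Y) = (Dᴴ_X α)(Y) - (Dᴴ_Y α)(X)`. -/
def dHForm (Γ : E × E → E × E) (α : E × E → E →L[ℝ] ℝ) (p : E × E) : E →L[ℝ] E →L[ℝ] ℝ :=
  horCovForm Γ α p - (horCovForm Γ α p).flip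

/-- The tensor field `U` along the projection with `g(U X, Y) = dᴴ(J θ_L)(X, Y)`, where
`J θ_L = θ_L ∘ J`. -/
def uTensor (g : E → E →L[ℝ] E →L[ℝ] ℝ) (L : E × E → ℝ) (J : E → E →L[ℝ] E) (p : E × E)
    (X : E) : E :=
  sharp (g p.1) (dHForm (lagrangeField L) (fun p' => (theta L p').comp (J p'.1)) p X)

/-- The vector field `X_f` along the projection with `g(X_f, Y) = -dᴴf(Y)`. -/
def xField (g : E → E →L[ℝ] E →L[ℝ] ℝ) (L : E × E → ℝ) (f : E → ℝ) (p : E × E) : E :=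
  sharp (g p.1) (-dH (lagrangeField L) f p)

/-- The Christoffel symbols of the Levi-Civita connection of `g`, `(a, b) ↦ Γⁱⱼₖ aʲ bᵏ`, through
`g(Γ(a, b), c) = ½ (∂_a g(b, c) + ∂_b g(a, c) - ∂_c g(a, b))`. -/
def christoffel (g : E → E →L[ℝ] E →L[ℝ] ℝ) (x a b : E) : E :=
  sharp (g x) ((1 / 2 : ℝ) •
    (fderiv ℝ g x a b + fderiv ℝ g x b a - ((fderiv ℝ g x).flip a).flip b))

/-- The Levi-Civita covariant derivative `(∇_c K)(a, b)` of a type (0,2) tensor field `K` on the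
base. -/
def covDerivForm (g K : E → E →L[ℝ] E →L[ℝ] ℝ) (x c a b : E) : ℝ :=
  fderiv ℝ K x c a b - K x (christoffel g x c a) b - K x a (christoffel g x c b)

/-- The type (0,2) tensor field `g(a, J b)` obtained from `J` by lowering an index. -/
def lowered (g : E → E →L[ℝ] E →L[ℝ] ℝ) (J : E → E →L[ℝ] E) (x : E) : E →L[ℝ] E →L[ℝ] ℝ :=
  (g x).bilinearComp (ContinuousLinearMap.id ℝ E) (J x)

/-!
### Tensor fields on a manifold and their representatives in charts
-/

variable {Q : Type*} [TopologicalSpace Q] [ChartedSpace E Q]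

/-- The representative `g_{ij}` of a type (0,2) tensor field in the chart `e`. -/
def formInChart
    (g : ∀ q : Q, TangentSpace 𝓘(ℝ, E) q →L[ℝ] TangentSpace 𝓘(ℝ, E) q →L[ℝ] ℝ)
    (e : OpenPartialHomeomorph Q E) (x : E) : E →L[ℝ] E →L[ℝ] ℝ :=
  ContinuousLinearMap.bilinearComp (E := E) (F := E) (g (e.symm x))
    (mfderiv 𝓘(ℝ, E) 𝓘(ℝ, E) e.symm x) (mfderiv 𝓘(ℝ, E) 𝓘(ℝ, E) e.symm x)

/-- The representative `Jⁱⱼ` of a type (1,1) tensor field in the chart `e`. -/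
def tensorInChart (J : ∀ q : Q, TangentSpace 𝓘(ℝ, E) q →L[ℝ] TangentSpace 𝓘(ℝ, E) q)
    (e : OpenPartialHomeomorph Q E) (x : E) : E →L[ℝ] E :=
  ContinuousLinearMap.comp (mfderiv 𝓘(ℝ, E) 𝓘(ℝ, E) e (e.symm x))
    (ContinuousLinearMap.comp (J (e.symm x)) (mfderiv 𝓘(ℝ, E) 𝓘(ℝ, E) e.symm x))

/-- The representative of a function in the chart `e`. -/
def funInChart (f : Q → ℝ) (e : OpenPartialHomeomorph Q E) (x : E) : ℝ := f (e.symm x)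

variable (E Q) in
/-- The smooth charts of `Q`. -/
def smoothCharts : Set (OpenPartialHomeomorph Q E) := IsManifold.maximalAtlas 𝓘(ℝ, E) ∞ Q

variable (E Q) in
/-- A smooth pseudo-Riemannian metric: a smooth symmetric non-singular type (0,2) tensor field. -/
structure PseudoMetric where
  val : ∀ q : Q, TangentSpace 𝓘(ℝ, E) q →L[ℝ] TangentSpace 𝓘(ℝ, E) q →L[ℝ] ℝ
  symm : ∀ (q : Q) (a b : TangentSpace 𝓘(ℝ, E) q), val q a b = val q b a
  nondegenerate : ∀ (q : Q) (a : TangentSpace 𝓘(ℝ, E) q), (∀ b, val q a b = 0) → a = 0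
  smooth : ∀ e ∈ smoothCharts E Q, ContDiffOn ℝ ∞ (formInChart val e) e.target

variable (E Q) in
/-- A smooth type (1,1) tensor field on `Q`. -/
structure EndoField where
  val : ∀ q : Q, TangentSpace 𝓘(ℝ, E) q →L[ℝ] TangentSpace 𝓘(ℝ, E) q
  smooth : ∀ e ∈ smoothCharts E Q, ContDiffOn ℝ ∞ (tensorInChart val e) e.target

/-- The Lagrangian `L = ½ g(u, u)` in the coordinates of `TQ` induced by the chart `e`. -/
def PseudoMetric.lagrangian (g : PseudoMetric E Q) (e : OpenPartialHomeomorph Q E) :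
    E × E → ℝ :=
  kinetic (formInChart g.val e)

/-- `J` is symmetric with respect to `g`. -/
def IsSymmetric (g : PseudoMetric E Q) (J : EndoField E Q) : Prop :=
  ∀ (q : Q) (a b : TangentSpace 𝓘(ℝ, E) q), g.val q (J.val q a) b = g.val q a (J.val q b)

/-- The identity `𝓛_Γ R = Γ ⊗ df - ξ_f ⊗ dE_L` of tensor fields on `TQ`: it holds at every point
of every induced chart of `TQ`. -/
def GaugedInvariance (g : PseudoMetric E Q) (J : EndoField E Q) (f : Q → ℝ) : Prop :=
  ∀ e ∈ smoothCharts E Q, ∀ x ∈ e.target, ∀ u : E, ∀ ξ : E × E,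
    let L := g.lagrangian e
    let F : E × E → ℝ := fun p => funInChart f e p.1
    lieDerivTensor (lagrangeField L) (recursionTensor L (tensorInChart J.val e)) (x, u) ξ =
      fderiv ℝ F (x, u) ξ • lagrangeField L (x, u) -
        fderiv ℝ (energy L) (x, u) ξ • hamField L F (x, u)

/-- The identity `∇J = ½ (T ⊗ dᴴf - X_f ⊗ θ_L)` of type (1,1) tensor fields along the projection
`TQ → Q`. -/
def DynamicalKillingCondition (g : PseudoMetric E Q) (J : EndoField E Q) (f : Q → ℝ) : Prop :=
  ∀ e ∈ smoothCharts E Q, ∀ x ∈ e.target, ∀ u X : E,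
    let L := g.lagrangian e
    let Γ := lagrangeField L
    dynCovTensor Γ (fun p => tensorInChart J.val e p.1) (x, u) X =
      (1 / 2 : ℝ) • (dH Γ (funInChart f e) (x, u) X • totalT (x, u) -
        theta L (x, u) X • xField (formInChart g.val e) L (funInChart f e) (x, u))

/-- `J` is a special conformal Killing tensor of `g`, with function `f`: it is symmetric and
`J_{lj|k} = ½ (g_{lk} ∂f/∂qʲ + g_{jk} ∂f/∂qˡ)`, the bar denoting the Levi-Civita covariant
derivative. -/
def IsSpecialConformalKilling (g : PseudoMetric E Q) (J : EndoField E Q) (f : Q → ℝ) : Prop :=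
  IsSymmetric g J ∧
  ∀ e ∈ smoothCharts E Q, ∀ x ∈ e.target, ∀ c a b : E,
    let G := formInChart g.val e
    let df := fderiv ℝ (funInChart f e) x
    covDerivForm G (lowered G (tensorInChart J.val e)) x c a b =
      1 / 2 * (G x a c * df b + G x b c * df a)

/-- The identity `U = -½ (T ⊗ dᴴf + X_f ⊗ θ_L)`. -/
def UFormula (g : PseudoMetric E Q) (J : EndoField E Q) (f : Q → ℝ) : Prop :=
  ∀ e ∈ smoothCharts E Q, ∀ x ∈ e.target, ∀ u X : E,
    let G := formInChart g.val e
    let L := g.lagrangian e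
    uTensor G L (tensorInChart J.val e) (x, u) X =
      -((1 / 2 : ℝ) • (dH (lagrangeField L) (funInChart f e) (x, u) X • totalT (x, u) +
        theta L (x, u) X • xField G L (funInChart f e) (x, u)))

/-- The identity `Φ J - J Φ = ½ (T ⊗ ∇dᴴf + ∇X_f ⊗ θ_L)`. -/
def JacobiCommutatorFormula (g : PseudoMetric E Q) (J : EndoField E Q) (f : Q → ℝ) : Prop :=
  ∀ e ∈ smoothCharts E Q, ∀ x ∈ e.target, ∀ u X : E,
    let L := g.lagrangian e
    let Γ := lagrangeField L
    let Jx := tensorInChart J.val e x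
    jacobiEndo Γ (x, u) (Jx X) - Jx (jacobiEndo Γ (x, u) X) =
      (1 / 2 : ℝ) • (dynCovForm Γ (dH Γ (funInChart f e)) (x, u) X • totalT (x, u) +
        theta L (x, u) X •
          dynCov Γ (xField (formInChart g.val e) L (funInChart f e)) (x, u))

/-- The identity `R = Jᶜ - Δ ⊗ df` of tensor fields on `TQ`. -/
def RFormula (g : PseudoMetric E Q) (J : EndoField E Q) (f : Q → ℝ) : Prop :=
  ∀ e ∈ smoothCharts E Q, ∀ x ∈ e.target, ∀ u : E, ∀ ξ : E × E,
    recursionTensor (g.lagrangian e) (tensorInChart J.val e) (x, u) ξ =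
      completeLift (tensorInChart J.val e) (x, u) ξ -
        fderiv ℝ (fun p : E × E => funInChart f e p.1) (x, u) ξ • liouville (x, u)

end TangentGeometry

end

/-!
The argument takes place in a chart, where `G` denotes the metric, `p = (q, u)` a point of `TQ` and
`Γ(·, ·)` (`chr`) the Christoffel symbols. There the Euler-Lagrange field of the kinetic energy is
the geodesic spray, its non-linear connection is `Γ(u, ·)`, and
`ω_L(ξ, η) = G(ξᵛ, η₁) - G(ηᵛ, ξ₁)` with `ξᵛ = ξ₂ + Γ(u, ξ₁)` the vertical part, so `ω_L` is
non-degenerate.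

Since `𝓛_Γ ω_L = 0`, contracting `𝓛_Γ R` with `ω_L` gives `𝓛_Γ ω₁ = d(𝓛_Γ θ₁)`, where
`θ₁ = dL ∘ Jᶜ ∘ S`; the right-hand side of condition (a) becomes `dE_L ∧ df = d(L df)`, as `E_L = L`
for a kinetic energy. Hence (a) says that `𝓛_Γ θ₁ - L df` (`gaugeForm`) is closed
(`gaugedInvariance_iff`). The restriction of its differential to vertical vectors is the
antisymmetric part of `G(·, J ·)`, so closedness forces `J` to be symmetric. For symmetric `J`,
subtracting the exact form `d(½ G(u, J u))` leaves the semi-basic form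
`(∇_u J)(u, ·) - ½ (∇_· J)(u, u) - ½ G(u, u) df`, which is quadratic in `u`. A closed semi-basic
form does not depend on `u`, so this one vanishes, and polarising it gives
`(∇_c J)(a, b) = ½ (G(a, c) df(b) + G(b, c) df(a))`, the special conformal Killing equation
(`SCKAt`, `sckAt_of_gauge`). Conversely this equation makes the semi-basic form zero, so that
`𝓛_Γ θ₁ - L df` is exact (`gauge_of_sckAt`). No integrability condition on the curvature enters.

Condition (b) is the same equation contracted with `u` (`sckAt_iff`), because the dynamical
covariant derivative of a basic tensor field is `∇_u`. The formulas for `R` and `U` follow by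
inserting the equation into the expressions of `ω₁` and `dᴴ(J θ_L)` through `∇J`
(`recursionTensor_eq`, `uTensor_eq`). Finally, `R Xᴴ = (J X)ᴴ + (U X)ⱽ` and `R Xⱽ = (J X)ⱽ`, so the
vertical component of (a) on `Xᴴ` reads `Φ J - J Φ + ∇U = 0`; the formula for `U`, with `∇T = 0` and
`∇θ_L = 0`, turns this into the commutator formula (`jacobiEndo_commutator`).
-/

noncomputable section

-- The default depth does not find the norms of spaces of multilinear maps.
set_option maxSynthPendingDepth 3

open scoped Topology

namespace TangentGeometry

/-! ### Exterior and Lie derivatives on a vector space -/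

section Calculus

variable {V : Type*} [NormedAddCommGroup V] [NormedSpace ℝ V]

variable (V) in
/-- Transposition of bilinear forms, as a continuous linear map. -/
def flipCLM : (V →L[ℝ] V →L[ℝ] ℝ) →L[ℝ] (V →L[ℝ] V →L[ℝ] ℝ) :=
  ((ContinuousLinearMap.flipₗᵢ ℝ V V ℝ).toContinuousLinearEquiv :
    (V →L[ℝ] V →L[ℝ] ℝ) →L[ℝ] (V →L[ℝ] V →L[ℝ] ℝ))

theorem extD_apply (α : V → V →L[ℝ] ℝ) (p ξ η : V) :
    extD α p ξ η = fderiv ℝ α p ξ η - fderiv ℝ α p η ξ := rfl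

theorem extD_congr {α β : V → V →L[ℝ] ℝ} {p : V} (h : α =ᶠ[𝓝 p] β) : extD α p = extD β p := by
  simp only [extD, h.fderiv_eq]

theorem extD_sub {α β : V → V →L[ℝ] ℝ} {p : V} (hα : DifferentiableAt ℝ α p)
    (hβ : DifferentiableAt ℝ β p) : extD (fun p => α p - β p) p = extD α p - extD β p := by
  ext ξ η
  simp only [extD_apply, fderiv_fun_sub hα hβ, sub_apply]
  ring

theorem _root_.ContDiffAt.fderiv_fderiv_symm {F : Type*} [NormedAddCommGroup F]
    [NormedSpace ℝ F] {φ : V → F} {p : V} (hφ : ContDiffAt ℝ ∞ φ p) : IsSymmSndFDerivAt ℝ φ p := by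
  refine hφ.isSymmSndFDerivAt ?_
  rw [minSmoothness_of_isRCLikeNormedField]
  exact WithTop.coe_le_coe.2 (le_top : (2 : ℕ∞) ≤ ⊤)

theorem extD_fderiv {φ : V → ℝ} {p : V} (hφ : ContDiffAt ℝ ∞ φ p) : extD (fderiv ℝ φ) p = 0 := by
  ext ξ η
  have h : IsSymmSndFDerivAt ℝ φ p := hφ.fderiv_fderiv_symm
  simp only [extD_apply, h.eq ξ η, sub_self, zero_apply]

theorem _root_.ContDiffAt.differentiableAt_fderiv {F : Type*} [NormedAddCommGroup F]
    [NormedSpace ℝ F] {φ : V → F} {p : V} (hφ : ContDiffAt ℝ ∞ φ p) :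
    DifferentiableAt ℝ (fderiv ℝ φ) p :=
  (hφ.fderiv_right (m := ∞) (by simp)).differentiableAt (by simp)

theorem _root_.ContDiffAt.diff {F : Type*} [NormedAddCommGroup F]
    [NormedSpace ℝ F] {φ : V → F} {p : V} (hφ : ContDiffAt ℝ ∞ φ p) :
    DifferentiableAt ℝ φ p := hφ.differentiableAt (by simp)

theorem extD_smul_fderiv {φ ψ : V → ℝ} {p : V} (hφ : DifferentiableAt ℝ φ p)
    (hψ : ContDiffAt ℝ ∞ ψ p) (ξ η : V) :
    extD (fun p => φ p • fderiv ℝ ψ p) p ξ η =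
      fderiv ℝ φ p ξ * fderiv ℝ ψ p η - fderiv ℝ φ p η * fderiv ℝ ψ p ξ := by
  have h : IsSymmSndFDerivAt ℝ ψ p := hψ.fderiv_fderiv_symm
  simp only [extD_apply, fderiv_fun_smul hφ hψ.differentiableAt_fderiv, add_apply,
    ContinuousLinearMap.smulRight_apply, smul_apply, smul_eq_mul, h.eq ξ η]
  ring

/-- The Lie derivative `𝓛_Γ α` of a 1-form, evaluated on constant vector fields. -/
def lieDerivForm (Γ : V → V) (α : V → V →L[ℝ] ℝ) (p : V) : V →L[ℝ] ℝ :=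
  fderiv ℝ α p (Γ p) + (α p).comp (fderiv ℝ Γ p)

/-- The Lie derivative `𝓛_Γ B` of a type (0,2) tensor field, evaluated on constant vector
fields. -/
def lieDerivBilin (Γ : V → V) (B : V → V →L[ℝ] V →L[ℝ] ℝ) (p ξ η : V) : ℝ :=
  fderiv ℝ B p (Γ p) ξ η + B p (fderiv ℝ Γ p ξ) η + B p ξ (fderiv ℝ Γ p η)

/-- Cartan's formula `𝓛_Γ α = i_Γ dα + d(α(Γ))`. -/
theorem lieDerivForm_eq_cartan {Γ : V → V} {α : V → V →L[ℝ] ℝ} {p : V}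
    (hΓ : DifferentiableAt ℝ Γ p) (hα : DifferentiableAt ℝ α p) :
    lieDerivForm Γ α p = extD α p (Γ p) + fderiv ℝ (fun p => α p (Γ p)) p := by
  ext η
  simp only [lieDerivForm, extD_apply, fderiv_clm_apply hα hΓ, add_apply,
    ContinuousLinearMap.comp_apply, ContinuousLinearMap.flip_apply]
  ring

theorem lieDerivForm_contDiffAt {Γ : V → V} {α : V → V →L[ℝ] ℝ} {p : V}
    (hΓ : ContDiffAt ℝ ∞ Γ p) (hα : ContDiffAt ℝ ∞ α p) :
    ContDiffAt ℝ ∞ (lieDerivForm Γ α) p :=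
  ((hα.fderiv_right (m := ∞) (by simp)).clm_apply hΓ).add
    (hα.clm_comp (hΓ.fderiv_right (m := ∞) (by simp)))

/-- The Lie derivative commutes with the exterior derivative. -/
theorem extD_lieDerivForm {Γ : V → V} {α : V → V →L[ℝ] ℝ} {p : V}
    (hΓ : ContDiffAt ℝ ∞ Γ p) (hα : ContDiffAt ℝ ∞ α p) (ξ η : V) :
    extD (lieDerivForm Γ α) p ξ η = lieDerivBilin Γ (extD α) p ξ η := by
  have hα1 := hα.differentiableAt_fderiv
  have hΓ1 := hΓ.differentiableAt_fderiv
  have hαs : IsSymmSndFDerivAt ℝ α p := hα.fderiv_fderiv_symm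
  have hΓs : IsSymmSndFDerivAt ℝ Γ p := hΓ.fderiv_fderiv_symm
  have h1 : HasFDerivAt (lieDerivForm Γ α) _ p :=
    (hα1.hasFDerivAt.clm_apply hΓ.diff.hasFDerivAt).add
      (hα.diff.hasFDerivAt.clm_comp hΓ1.hasFDerivAt)
  have hflip : HasFDerivAt (fun q => (fderiv ℝ α q).flip) _ p :=
    (flipCLM V).hasFDerivAt.comp p hα1.hasFDerivAt
  have h2 : HasFDerivAt (extD α) _ p := hα1.hasFDerivAt.sub hflip
  have e0 : fderiv ℝ (extD α) p (Γ p) ξ η = fderiv ℝ (fderiv ℝ α) p (Γ p) ξ η -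
      fderiv ℝ (fderiv ℝ α) p (Γ p) η ξ := by
    rw [h2.fderiv]
    rfl
  simp only [lieDerivBilin, e0]
  simp only [extD_apply, h1.fderiv]
  have e1 := congrArg (fun T : V →L[ℝ] ℝ => T η) (hαs.eq ξ (Γ p))
  have e2 := congrArg (fun T : V →L[ℝ] ℝ => T ξ) (hαs.eq η (Γ p))
  have e3 := hΓs.eq ξ η
  simp at e1 e2 ⊢
  rw [e1, e2, e3]
  ring

theorem isInvertible_of_nondegenerate [FiniteDimensional ℝ V] {B : V →L[ℝ] V →L[ℝ] ℝ}
    (h : ∀ a, (∀ b, B a b = 0) → a = 0) : B.IsInvertible := by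
  have hinj : Function.Injective B.toLinearMap :=
    (injective_iff_map_eq_zero B.toLinearMap).2 fun a ha => h a fun b => by
      have : B a = 0 := ha
      simp [this]
  have hrank : Module.finrank ℝ V = Module.finrank ℝ (V →L[ℝ] ℝ) := by
    rw [(LinearMap.toContinuousLinearMap (𝕜 := ℝ) (E := V) (F' := ℝ)).symm.finrank_eq]
    exact (Subspace.dual_finrank_eq (K := ℝ) (V := V)).symm
  refine ⟨(LinearMap.linearEquivOfInjective B.toLinearMap hinj hrank).toContinuousLinearEquiv,
    ?_⟩
  ext a b
  rfl

theorem apply_sharp {B : V →L[ℝ] V →L[ℝ] ℝ} (hB : B.IsInvertible) (α : V →L[ℝ] ℝ) :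
    B (sharp B α) = α := hB.self_apply_inverse α

theorem sharp_eq {B : V →L[ℝ] V →L[ℝ] ℝ} (hB : B.IsInvertible) {α : V →L[ℝ] ℝ} {v : V}
    (h : ∀ b, B v b = α b) : sharp B α = v := by
  apply hB.injective
  rw [apply_sharp hB]
  ext b
  exact (h b).symm

/-- If `i_{R ξ} B = i_ξ C`, then `i_{(𝓛_Γ R) ξ} B = i_ξ 𝓛_Γ C - i_{R ξ} 𝓛_Γ B`. -/
theorem apply_lieDerivTensor {Γ : V → V} {B C : V → V →L[ℝ] V →L[ℝ] ℝ} {R : V → V →L[ℝ] V}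
    {p : V} (hB : DifferentiableAt ℝ B p) (hC : DifferentiableAt ℝ C p)
    (hR : DifferentiableAt ℝ R p) (h : ∀ᶠ q in 𝓝 p, ∀ ξ, B q (R q ξ) = C q ξ) (ξ η : V) :
    B p (lieDerivTensor Γ R p ξ) η =
      lieDerivBilin Γ C p ξ η - lieDerivBilin Γ B p (R p ξ) η := by
  have hRξ : DifferentiableAt ℝ (fun q => R q ξ) p := hR.clm_apply (differentiableAt_const ξ)
  have e : fderiv ℝ (fun q => B q (R q ξ)) p = fderiv ℝ (fun q => C q ξ) p :=
    Filter.EventuallyEq.fderiv_eq (h.mono fun q hq => hq ξ)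
  rw [fderiv_clm_apply hB hRξ, fderiv_clm_apply hC (differentiableAt_const ξ)] at e
  have e' := congrArg (fun T : V →L[ℝ] V →L[ℝ] ℝ => T (Γ p) η) e
  have h0 := h.self_of_nhds
  simp [lieDerivTensor, VectorField.lieBracket, lieDerivBilin, h0] at e' ⊢
  linarith

/-- The Lie derivative of a type (1,1) tensor field is tensorial in its argument. -/
theorem lieDerivTensor_apply_field {Γ : V → V} {R : V → V →L[ℝ] V} {ζ : V → V} {p : V}
    (hR : DifferentiableAt ℝ R p) (hζ : DifferentiableAt ℝ ζ p) :
    lieDerivTensor Γ R p (ζ p) =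
      VectorField.lieBracket ℝ Γ (fun q => R q (ζ q)) p -
        R p (VectorField.lieBracket ℝ Γ ζ p) := by
  simp [lieDerivTensor, VectorField.lieBracket, fderiv_clm_apply hR hζ,
    fderiv_clm_apply hR (differentiableAt_const (ζ p))]
  abel

end Calculus

/-! ### The geodesic spray of a local metric -/

variable {E : Type*} [NormedAddCommGroup E] [NormedSpace ℝ E]

/-- `G` is a smooth pseudo-Riemannian metric on the coordinate domain `U`. -/
structure IsLocalMetric (G : E → E →L[ℝ] E →L[ℝ] ℝ) (U : Set E) : Prop where
  isOpen : IsOpen U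
  smooth : ContDiffOn ℝ ∞ G U
  symm : ∀ x ∈ U, ∀ a b, G x a b = G x b a
  nondegenerate : ∀ x ∈ U, ∀ a, (∀ b, G x a b = 0) → a = 0

/-- The Christoffel symbols `christoffel G x`, bundled as a continuous bilinear map. -/
def chr (G : E → E →L[ℝ] E →L[ℝ] ℝ) (x : E) : E →L[ℝ] E →L[ℝ] E :=
  (ContinuousLinearMap.compL ℝ E (E →L[ℝ] ℝ) E (G x).inverse).comp
    ((1 / 2 : ℝ) • (fderiv ℝ G x + (fderiv ℝ G x).flip - (flipCLM E).comp (fderiv ℝ G x).flip))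

theorem chr_apply (G : E → E →L[ℝ] E →L[ℝ] ℝ) (x a b : E) :
    chr G x a b = christoffel G x a b := rfl

theorem hasFDerivAt_base {F : Type*} [NormedAddCommGroup F] [NormedSpace ℝ F] {K : E → F}
    {p : E × E} (hK : DifferentiableAt ℝ K p.1) :
    HasFDerivAt (fun q : E × E => K q.1)
      ((fderiv ℝ K p.1).comp (ContinuousLinearMap.fst ℝ E E)) p :=
  hK.hasFDerivAt.comp p hasFDerivAt_fst

theorem fderiv_base {F : Type*} [NormedAddCommGroup F] [NormedSpace ℝ F] {K : E → F}
    {p : E × E} (hK : DifferentiableAt ℝ K p.1) (ξ : E × E) :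
    fderiv ℝ (fun q : E × E => K q.1) p ξ = fderiv ℝ K p.1 ξ.1 := by
  rw [(hasFDerivAt_base hK).fderiv]
  rfl

theorem contDiffAt_base {F : Type*} [NormedAddCommGroup F] [NormedSpace ℝ F] {K : E → F}
    {p : E × E} (hK : ContDiffAt ℝ ∞ K p.1) : ContDiffAt ℝ ∞ (fun q : E × E => K q.1) p :=
  hK.comp p contDiffAt_fst

theorem fderiv_linear {F : Type*} [NormedAddCommGroup F] [NormedSpace ℝ F] {K : E → E →L[ℝ] F}
    {p : E × E} (hK : DifferentiableAt ℝ K p.1) (ξ : E × E) :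
    fderiv ℝ (fun q : E × E => K q.1 q.2) p ξ = fderiv ℝ K p.1 ξ.1 p.2 + K p.1 ξ.2 := by
  rw [((hasFDerivAt_base hK).clm_apply hasFDerivAt_snd).fderiv]
  simp [add_comm]

theorem fderiv_quadratic {F : Type*} [NormedAddCommGroup F] [NormedSpace ℝ F]
    {K : E → E →L[ℝ] E →L[ℝ] F} {p : E × E} (hK : DifferentiableAt ℝ K p.1) (ξ : E × E) :
    fderiv ℝ (fun q : E × E => K q.1 q.2 q.2) p ξ =
      fderiv ℝ K p.1 ξ.1 p.2 p.2 + K p.1 ξ.2 p.2 + K p.1 p.2 ξ.2 := by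
  rw [(((hasFDerivAt_base hK).clm_apply hasFDerivAt_snd).clm_apply hasFDerivAt_snd).fderiv]
  simp
  abel

theorem fderiv_bilin_symm {K : E → E →L[ℝ] E →L[ℝ] ℝ} {x : E} (hK : DifferentiableAt ℝ K x)
    (hs : ∀ᶠ y in 𝓝 x, ∀ a b, K y a b = K y b a) (c a b : E) :
    fderiv ℝ K x c a b = fderiv ℝ K x c b a := by
  have e : ∀ a b : E, fderiv ℝ K x c a b = fderiv ℝ (fun y => K y a b) x c := fun a b => by
    rw [((hK.hasFDerivAt.clm_apply (hasFDerivAt_const a x)).clm_apply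
      (hasFDerivAt_const b x)).fderiv]
    simp
  rw [e, e]
  congr 1
  exact Filter.EventuallyEq.fderiv_eq (hs.mono fun y hy => hy a b)

namespace IsLocalMetric

variable {G : E → E →L[ℝ] E →L[ℝ] ℝ} {U : Set E} (h : IsLocalMetric G U)
include h

theorem mem_nhds {x : E} (hx : x ∈ U) : U ∈ 𝓝 x := h.isOpen.mem_nhds hx

theorem eventually {p : E × E} (hp : p.1 ∈ U) : ∀ᶠ q : E × E in 𝓝 p, q.1 ∈ U :=
  continuous_fst.continuousAt.eventually (h.mem_nhds hp)

theorem contDiffAt {x : E} (hx : x ∈ U) : ContDiffAt ℝ ∞ G x :=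
  h.smooth.contDiffAt (h.mem_nhds hx)

theorem fderiv_symm {x : E} (hx : x ∈ U) (c a b : E) :
    fderiv ℝ G x c a b = fderiv ℝ G x c b a :=
  fderiv_bilin_symm (h.contDiffAt hx).diff (Filter.mem_of_superset (h.mem_nhds hx) h.symm) c a b

theorem fderiv_kinetic {p : E × E} (hp : p.1 ∈ U) (ξ : E × E) :
    fderiv ℝ (kinetic G) p ξ = 1 / 2 * fderiv ℝ G p.1 ξ.1 p.2 p.2 + G p.1 p.2 ξ.2 := by
  have e : kinetic G = fun q => (1 / 2 : ℝ) • G q.1 q.2 q.2 := rfl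
  have hG := (h.contDiffAt hp).diff
  rw [e, fderiv_fun_const_smul (((hasFDerivAt_base hG).clm_apply
    hasFDerivAt_snd).clm_apply hasFDerivAt_snd).differentiableAt, smul_apply,
    fderiv_quadratic hG, h.symm _ hp ξ.2 p.2]
  simp only [smul_eq_mul]
  ring

theorem contDiffAt_kinetic {p : E × E} (hp : p.1 ∈ U) : ContDiffAt ℝ ∞ (kinetic G) p :=
  contDiffAt_const.mul
    (((contDiffAt_base (h.contDiffAt hp)).clm_apply contDiffAt_snd).clm_apply contDiffAt_snd)

theorem theta_apply {p : E × E} (hp : p.1 ∈ U) (a : E) : theta (kinetic G) p a = G p.1 p.2 a := by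
  simp [theta, vLift, h.fderiv_kinetic hp]

theorem theta_eq {p : E × E} (hp : p.1 ∈ U) : theta (kinetic G) p = G p.1 p.2 := by
  ext a
  exact h.theta_apply hp a

theorem thetaForm_eq {p : E × E} (hp : p.1 ∈ U) :
    thetaForm (kinetic G) p = (G p.1 p.2).comp (ContinuousLinearMap.fst ℝ E E) := by
  ext ξ <;> simp [thetaForm, vertEndo, vLift, h.fderiv_kinetic hp]

theorem contDiffAt_thetaForm {p : E × E} (hp : p.1 ∈ U) :
    ContDiffAt ℝ ∞ (thetaForm (kinetic G)) p := by
  have : thetaForm (kinetic G) =ᶠ[𝓝 p]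
      fun q => (G q.1 q.2).comp (ContinuousLinearMap.fst ℝ E E) :=
    (h.eventually hp).mono fun q hq => h.thetaForm_eq hq
  exact (((contDiffAt_base (h.contDiffAt hp)).clm_apply contDiffAt_snd).clm_comp
    contDiffAt_const).congr_of_eventuallyEq this

theorem energy_eq {p : E × E} (hp : p.1 ∈ U) : energy (kinetic G) p = kinetic G p := by
  simp only [energy, liouville, h.fderiv_kinetic hp, kinetic]
  simp
  ring

theorem energy_eventuallyEq {p : E × E} (hp : p.1 ∈ U) :
    energy (kinetic G) =ᶠ[𝓝 p] kinetic G :=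
  (h.eventually hp).mono fun _ hq => h.energy_eq hq

end IsLocalMetric

/-- The exterior derivative of a semi-basic 1-form `A_j(q, u) dqʲ`. -/
theorem extD_semibasic {A : E × E → E →L[ℝ] ℝ} {p : E × E} (hA : DifferentiableAt ℝ A p)
    (ξ η : E × E) :
    extD (fun q => (A q).comp (ContinuousLinearMap.fst ℝ E E)) p ξ η =
      fderiv ℝ A p ξ η.1 - fderiv ℝ A p η ξ.1 := by
  rw [extD_apply, (hA.hasFDerivAt.clm_comp (hasFDerivAt_const _ p)).fderiv]
  simp

namespace IsLocalMetric

variable {G : E → E →L[ℝ] E →L[ℝ] ℝ} {U : Set E} (h : IsLocalMetric G U)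
include h

theorem omega_apply {p : E × E} (hp : p.1 ∈ U) (ξ η : E × E) :
    omega (kinetic G) p ξ η =
      fderiv ℝ G p.1 ξ.1 p.2 η.1 + G p.1 ξ.2 η.1 -
        (fderiv ℝ G p.1 η.1 p.2 ξ.1 + G p.1 η.2 ξ.1) := by
  have : thetaForm (kinetic G) =ᶠ[𝓝 p]
      fun q => (G q.1 q.2).comp (ContinuousLinearMap.fst ℝ E E) :=
    (h.eventually hp).mono fun q hq => h.thetaForm_eq hq
  have hG := (h.contDiffAt hp).diff
  rw [omega, extD_congr this,
    extD_semibasic ((hasFDerivAt_base hG).clm_apply hasFDerivAt_snd).differentiableAt,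
    fderiv_linear hG, fderiv_linear hG]
  rfl

theorem contDiffAt_omega {p : E × E} (hp : p.1 ∈ U) : ContDiffAt ℝ ∞ (omega (kinetic G)) p := by
  have hD : ContDiffAt ℝ ∞ (fderiv ℝ (thetaForm (kinetic G))) p :=
    (h.contDiffAt_thetaForm hp).fderiv_right (m := ∞) (by simp)
  exact hD.sub ((ContinuousLinearMap.flipₗᵢ ℝ (E × E) (E × E) ℝ).contDiff.contDiffAt.comp p hD)

variable [FiniteDimensional ℝ E]

theorem isInvertible {x : E} (hx : x ∈ U) : (G x).IsInvertible :=
  isInvertible_of_nondegenerate (h.nondegenerate x hx)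

theorem contDiffAt_chr {x : E} (hx : x ∈ U) : ContDiffAt ℝ ∞ (chr G) x := by
  have hG := h.contDiffAt hx
  have hD : ContDiffAt ℝ ∞ (fderiv ℝ G) x := hG.fderiv_right (m := ∞) (by simp)
  have : CompleteSpace E := FiniteDimensional.complete ℝ E
  have hI : ContDiffAt ℝ ∞ (fun y => (G y).inverse) x :=
    ((h.isInvertible hx).contDiffAt_map_inverse).comp x hG
  have hF : ContDiffAt ℝ ∞ (fun y => (fderiv ℝ G y).flip) x :=
    ((ContinuousLinearMap.flipₗᵢ ℝ E E (E →L[ℝ] ℝ)).contDiff.contDiffAt).comp x hD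
  have hFF : ContDiffAt ℝ ∞ (fun y => (flipCLM E).comp (fderiv ℝ G y).flip) x :=
    contDiffAt_const.clm_comp hF
  have hc : ContDiffAt ℝ ∞
      (fun y => ContinuousLinearMap.compL ℝ E (E →L[ℝ] ℝ) E (G y).inverse) x :=
    contDiffAt_const.clm_apply hI
  exact hc.clm_comp (((hD.add hF).sub hFF).const_smul (1 / 2 : ℝ))

theorem apply_chr {x : E} (hx : x ∈ U) (a b c : E) :
    G x (chr G x a b) c = 1 / 2 *
      (fderiv ℝ G x a b c + fderiv ℝ G x b a c - fderiv ℝ G x c a b) := by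
  rw [chr_apply, christoffel, apply_sharp (h.isInvertible hx)]
  simp

theorem chr_symm {x : E} (hx : x ∈ U) (a b : E) : chr G x a b = chr G x b a := by
  refine sub_eq_zero.1 (h.nondegenerate x hx _ fun c => ?_)
  rw [map_sub, sub_apply, h.apply_chr hx, h.apply_chr hx, h.fderiv_symm hx c a b]
  ring

/-- The Levi-Civita connection is metric. -/
theorem fderiv_eq {x : E} (hx : x ∈ U) (c a b : E) :
    fderiv ℝ G x c a b = G x (chr G x c a) b + G x a (chr G x c b) := by
  rw [h.symm x hx a, h.apply_chr hx, h.apply_chr hx, h.fderiv_symm hx c a b,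
    h.fderiv_symm hx a c b, h.fderiv_symm hx b c a]
  ring

/-- `ω_L = g_{ij} δuⁱ ∧ dqʲ`, where `δu = du + Γ(u, dq)` is the vertical projection. -/
theorem omega_apply_eq {p : E × E} (hp : p.1 ∈ U) (ξ η : E × E) :
    omega (kinetic G) p ξ η = G p.1 (ξ.2 + chr G p.1 p.2 ξ.1) η.1 -
        G p.1 (η.2 + chr G p.1 p.2 η.1) ξ.1 := by
  rw [h.omega_apply hp, h.fderiv_eq hp, h.fderiv_eq hp, h.chr_symm hp ξ.1 p.2,
    h.chr_symm hp η.1 p.2, h.chr_symm hp η.1 ξ.1]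
  simp only [map_add, add_apply, h.symm _ hp (chr G p.1 p.2 _)]
  rw [h.symm _ hp ξ.1 (chr G p.1 p.2 η.1)]
  ring

theorem isInvertible_omega {p : E × E} (hp : p.1 ∈ U) : (omega (kinetic G) p).IsInvertible := by
  refine isInvertible_of_nondegenerate fun ξ hξ => ?_
  have h1 : ξ.1 = 0 := h.nondegenerate _ hp _ fun b => by
    have := hξ (0, b)
    rw [h.omega_apply_eq hp, h.symm _ hp _ ξ.1] at this
    simpa using this
  have h2 : ξ.2 = 0 := h.nondegenerate _ hp _ fun b => by
    have := hξ (b, 0)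
    rw [h.omega_apply_eq hp] at this
    simpa [h1] using this
  exact Prod.ext h1 h2

/-- The Euler-Lagrange field of the kinetic energy is the geodesic spray. -/
theorem lagrangeField_eq {p : E × E} (hp : p.1 ∈ U) :
    lagrangeField (kinetic G) p = (p.2, -chr G p.1 p.2 p.2) := by
  refine sharp_eq (h.isInvertible_omega hp) fun η => ?_
  rw [h.omega_apply_eq hp, (h.energy_eventuallyEq hp).fderiv_eq, neg_apply,
    h.fderiv_kinetic hp, h.fderiv_eq hp, h.chr_symm hp η.1, h.symm _ hp p.2 (chr _ _ _ _),
    h.symm _ hp p.2 η.2]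
  simp
  ring

end IsLocalMetric

/-! ### Gauged invariance as closedness of a 1-form -/

/-- The Levi-Civita covariant derivative `(∇_c J)(a)` of a type (1,1) tensor field on the base. -/
def covEndo (G : E → E →L[ℝ] E →L[ℝ] ℝ) (J : E → E →L[ℝ] E) (x c a : E) : E :=
  fderiv ℝ J x c a + chr G x c (J x a) - J x (chr G x c a)

/-- The 1-form `θ_L ∘ Jᶜ ∘ S` on `TQ`, with differential `ω₁`. -/
def thetaOne (L : E × E → ℝ) (J : E → E →L[ℝ] E) (p : E × E) : E × E →L[ℝ] ℝ :=
  (fderiv ℝ L p).comp ((completeLift J p).comp vertEndo)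

/-- The equation `J_{ab|c} = ½ (g_{ac} ∂φ/∂q^b + g_{bc} ∂φ/∂q^a)` of a special conformal Killing
tensor at the point `x`; the symmetry of `J` is not part of it. -/
def SCKAt (G : E → E →L[ℝ] E →L[ℝ] ℝ) (J : E → E →L[ℝ] E) (φ : E → ℝ) (x : E) : Prop :=
  ∀ c a b : E, G x a (covEndo G J x c b) =
    1 / 2 * (G x a c * fderiv ℝ φ x b + G x b c * fderiv ℝ φ x a)

theorem fderiv_apply_const {V F : Type*} [NormedAddCommGroup V] [NormedSpace ℝ V]
    [NormedAddCommGroup F] [NormedSpace ℝ F] {W : Type*} [NormedAddCommGroup W] [NormedSpace ℝ W]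
    {K : V → F →L[ℝ] W} {p : V} (hK : DifferentiableAt ℝ K p) (v : V) (w : F) :
    fderiv ℝ K p v w = fderiv ℝ (fun q => K q w) p v := by
  rw [fderiv_clm_apply hK (differentiableAt_const w)]
  simp

namespace IsLocalMetric

variable {G : E → E →L[ℝ] E →L[ℝ] ℝ} {J : E → E →L[ℝ] E} {φ : E → ℝ} {U : Set E}
  (h : IsLocalMetric G U)
include h

theorem contDiffAt_of_contDiffOn {F : Type*} [NormedAddCommGroup F] [NormedSpace ℝ F]
    {K : E → F} (hK : ContDiffOn ℝ ∞ K U) {x : E} (hx : x ∈ U) : ContDiffAt ℝ ∞ K x :=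
  hK.contDiffAt (h.mem_nhds hx)

theorem thetaOne_eq {p : E × E} (hp : p.1 ∈ U) :
    thetaOne (kinetic G) J p =
      ((G p.1 p.2).comp (J p.1)).comp (ContinuousLinearMap.fst ℝ E E) := by
  ext ξ <;> simp [thetaOne, completeLift, vertEndo, vLift, h.fderiv_kinetic hp]

theorem thetaOne_eventuallyEq {p : E × E} (hp : p.1 ∈ U) :
    thetaOne (kinetic G) J =ᶠ[𝓝 p]
      fun q => ((G q.1 q.2).comp (J q.1)).comp (ContinuousLinearMap.fst ℝ E E) :=
  (h.eventually hp).mono fun _ hq => h.thetaOne_eq hq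

theorem contDiffAt_thetaComp (hJ : ContDiffOn ℝ ∞ J U) {p : E × E} (hp : p.1 ∈ U) :
    ContDiffAt ℝ ∞ (fun q : E × E => (G q.1 q.2).comp (J q.1)) p :=
  ((contDiffAt_base (h.contDiffAt hp)).clm_apply contDiffAt_snd).clm_comp
    (contDiffAt_base (h.contDiffAt_of_contDiffOn hJ hp))

theorem contDiffAt_thetaOne (hJ : ContDiffOn ℝ ∞ J U) {p : E × E} (hp : p.1 ∈ U) :
    ContDiffAt ℝ ∞ (thetaOne (kinetic G) J) p :=
  ((h.contDiffAt_thetaComp hJ hp).clm_comp contDiffAt_const).congr_of_eventuallyEq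
    (h.thetaOne_eventuallyEq hp)

theorem contDiffAt_omegaOne (hJ : ContDiffOn ℝ ∞ J U) {p : E × E} (hp : p.1 ∈ U) :
    ContDiffAt ℝ ∞ (omegaOne (kinetic G) J) p := by
  have hD : ContDiffAt ℝ ∞ (fderiv ℝ (thetaOne (kinetic G) J)) p :=
    (h.contDiffAt_thetaOne hJ hp).fderiv_right (m := ∞) (by simp)
  exact hD.sub ((ContinuousLinearMap.flipₗᵢ ℝ (E × E) (E × E) ℝ).contDiff.contDiffAt.comp p hD)

variable [FiniteDimensional ℝ E]

theorem contDiffAt_lagrangeField {p : E × E} (hp : p.1 ∈ U) :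
    ContDiffAt ℝ ∞ (lagrangeField (kinetic G)) p := by
  have : lagrangeField (kinetic G) =ᶠ[𝓝 p] fun q => (q.2, -chr G q.1 q.2 q.2) :=
    (h.eventually hp).mono fun _ hq => h.lagrangeField_eq hq
  exact (contDiffAt_snd.prodMk (((contDiffAt_base (h.contDiffAt_chr hp)).clm_apply
    contDiffAt_snd).clm_apply contDiffAt_snd).neg).congr_of_eventuallyEq this

theorem fderiv_lagrangeField {p : E × E} (hp : p.1 ∈ U) (ξ : E × E) :
    fderiv ℝ (lagrangeField (kinetic G)) p ξ =
      (ξ.2, -(fderiv ℝ (chr G) p.1 ξ.1 p.2 p.2 + 2 • chr G p.1 p.2 ξ.2)) := by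
  have : lagrangeField (kinetic G) =ᶠ[𝓝 p] fun q => (q.2, -chr G q.1 q.2 q.2) :=
    (h.eventually hp).mono fun _ hq => h.lagrangeField_eq hq
  have hC := (h.contDiffAt_chr hp).diff
  have hq := (((hasFDerivAt_base hC).clm_apply hasFDerivAt_snd).clm_apply hasFDerivAt_snd)
  rw [this.fderiv_eq, (hasFDerivAt_snd.prodMk hq.fun_neg).fderiv]
  ext
  · simp
  · have e := fderiv_quadratic hC ξ
    rw [hq.fderiv] at e
    refine (congrArg Neg.neg e).trans ?_
    rw [h.chr_symm hp ξ.2 p.2, two_smul, add_assoc]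

theorem contDiffAt_recursionTensor (hJ : ContDiffOn ℝ ∞ J U) {p : E × E} (hp : p.1 ∈ U) :
    ContDiffAt ℝ ∞ (recursionTensor (kinetic G) J) p := by
  have : CompleteSpace E := FiniteDimensional.complete ℝ E
  exact ((h.isInvertible_omega hp).contDiffAt_map_inverse.comp p (h.contDiffAt_omega hp)).clm_comp
    (h.contDiffAt_omegaOne hJ hp)

theorem apply_recursionTensor {p : E × E} (hp : p.1 ∈ U) (ξ : E × E) :
    omega (kinetic G) p (recursionTensor (kinetic G) J p ξ) = omegaOne (kinetic G) J p ξ :=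
  (h.isInvertible_omega hp).self_apply_inverse _

/-- Covariant form of the derivative of `q ↦ G(u, J ·)`: the first term only sees the vertical part
of `ξ`. -/
theorem fderiv_thetaComp (hJ : ContDiffOn ℝ ∞ J U) {p : E × E} (hp : p.1 ∈ U) (ξ : E × E)
    (a : E) :
    fderiv ℝ (fun q : E × E => (G q.1 q.2).comp (J q.1)) p ξ a =
      G p.1 (ξ.2 + chr G p.1 p.2 ξ.1) (J p.1 a) + G p.1 p.2 (covEndo G J p.1 ξ.1 a) +
        G p.1 p.2 (J p.1 (chr G p.1 ξ.1 a)) := by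
  have hG := (h.contDiffAt hp).diff
  have hJ' := (h.contDiffAt_of_contDiffOn hJ hp).diff
  rw [(((hasFDerivAt_base hG).clm_apply hasFDerivAt_snd).clm_comp (hasFDerivAt_base hJ')).fderiv]
  simp [covEndo, h.fderiv_eq hp, h.chr_symm hp ξ.1 p.2]
  ring

theorem omegaOne_apply (hJ : ContDiffOn ℝ ∞ J U) {p : E × E} (hp : p.1 ∈ U) (ξ η : E × E) :
    omegaOne (kinetic G) J p ξ η =
      G p.1 (ξ.2 + chr G p.1 p.2 ξ.1) (J p.1 η.1) + G p.1 p.2 (covEndo G J p.1 ξ.1 η.1) -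
        (G p.1 (η.2 + chr G p.1 p.2 η.1) (J p.1 ξ.1) +
          G p.1 p.2 (covEndo G J p.1 η.1 ξ.1)) := by
  have e : omegaOne (kinetic G) J p = extD (thetaOne (kinetic G) J) p := rfl
  rw [e, extD_congr (h.thetaOne_eventuallyEq hp),
    extD_semibasic (h.contDiffAt_thetaComp hJ hp).diff, h.fderiv_thetaComp hJ hp,
    h.fderiv_thetaComp hJ hp, h.chr_symm hp ξ.1 η.1]
  ring

/-- `𝓛_Γ ω_L = 0`, since `𝓛_Γ θ_L = dL`. -/
theorem lieDerivBilin_omega {p : E × E} (hp : p.1 ∈ U) (ξ η : E × E) :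
    lieDerivBilin (lagrangeField (kinetic G)) (omega (kinetic G)) p ξ η = 0 := by
  have e : lieDerivForm (lagrangeField (kinetic G)) (thetaForm (kinetic G)) =ᶠ[𝓝 p]
      fderiv ℝ (kinetic G) := by
    filter_upwards [h.eventually hp] with q hq
    rw [lieDerivForm_eq_cartan (h.contDiffAt_lagrangeField hq).diff
      (h.contDiffAt_thetaForm hq).diff]
    have e1 : extD (thetaForm (kinetic G)) q (lagrangeField (kinetic G) q) =
        -fderiv ℝ (kinetic G) q := by
      rw [← (h.energy_eventuallyEq hq).fderiv_eq]
      exact apply_sharp (h.isInvertible_omega hq) _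
    have e2 : (fun q => thetaForm (kinetic G) q (lagrangeField (kinetic G) q)) =ᶠ[𝓝 q]
        fun q => (2 : ℝ) • kinetic G q := by
      filter_upwards [h.eventually hq] with r hr
      rw [h.thetaForm_eq hr, h.lagrangeField_eq hr]
      simp [kinetic]
    rw [e1, e2.fderiv_eq, fderiv_fun_const_smul (h.contDiffAt_kinetic hq).diff, two_smul]
    abel
  rw [omega, ← extD_lieDerivForm (h.contDiffAt_lagrangeField hp) (h.contDiffAt_thetaForm hp),
    extD_congr e, extD_fderiv (h.contDiffAt_kinetic hp)]
  rfl

/-- `i_{(𝓛_Γ R) ξ} ω_L = i_ξ d(𝓛_Γ θ₁)` with `θ₁ = dL ∘ Jᶜ ∘ S`. -/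
theorem omega_lieDerivTensor (hJ : ContDiffOn ℝ ∞ J U) {p : E × E} (hp : p.1 ∈ U)
    (ξ η : E × E) :
    omega (kinetic G) p (lieDerivTensor (lagrangeField (kinetic G))
      (recursionTensor (kinetic G) J) p ξ) η =
      extD (lieDerivForm (lagrangeField (kinetic G)) (thetaOne (kinetic G) J)) p ξ η := by
  rw [apply_lieDerivTensor (h.contDiffAt_omega hp).diff (h.contDiffAt_omegaOne hJ hp).diff
    (h.contDiffAt_recursionTensor hJ hp).diff
    ((h.eventually hp).mono fun q hq ξ => h.apply_recursionTensor hq ξ),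
    h.lieDerivBilin_omega hp, sub_zero,
    extD_lieDerivForm (h.contDiffAt_lagrangeField hp) (h.contDiffAt_thetaOne hJ hp)]
  rfl

end IsLocalMetric

/-- The 1-form `𝓛_Γ (dL ∘ Jᶜ ∘ S) - L df` on `TQ`. For a kinetic energy `L` is also the energy
`E_L`, so the differential of the subtracted term is `dE_L ∧ df`. -/
def gaugeForm (L : E × E → ℝ) (J : E → E →L[ℝ] E) (φ : E → ℝ) (p : E × E) : E × E →L[ℝ] ℝ :=
  lieDerivForm (lagrangeField L) (thetaOne L J) p - L p • fderiv ℝ (fun q : E × E => φ q.1) p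

namespace IsLocalMetric

variable {G : E → E →L[ℝ] E →L[ℝ] ℝ} {J : E → E →L[ℝ] E} {φ : E → ℝ} {U : Set E}
  (h : IsLocalMetric G U) [FiniteDimensional ℝ E]
include h

theorem contDiffAt_gaugeForm (hJ : ContDiffOn ℝ ∞ J U) (hφ : ContDiffOn ℝ ∞ φ U) {p : E × E}
    (hp : p.1 ∈ U) : ContDiffAt ℝ ∞ (gaugeForm (kinetic G) J φ) p :=
  (lieDerivForm_contDiffAt (h.contDiffAt_lagrangeField hp) (h.contDiffAt_thetaOne hJ hp)).sub
    ((h.contDiffAt_kinetic hp).smul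
      ((contDiffAt_base (h.contDiffAt_of_contDiffOn hφ hp)).fderiv_right (m := ∞) (by simp)))

/-- The identity `𝓛_Γ R = Γ ⊗ df - ξ_f ⊗ dE_L` says that `𝓛_Γ (dL ∘ Jᶜ ∘ S) - L df` is closed. -/
theorem gaugedInvariance_iff (hJ : ContDiffOn ℝ ∞ J U) (hφ : ContDiffOn ℝ ∞ φ U) {p : E × E}
    (hp : p.1 ∈ U) :
    (∀ ξ, lieDerivTensor (lagrangeField (kinetic G)) (recursionTensor (kinetic G) J) p ξ =
      fderiv ℝ (fun q : E × E => φ q.1) p ξ • lagrangeField (kinetic G) p -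
        fderiv ℝ (energy (kinetic G)) p ξ • hamField (kinetic G) (fun q => φ q.1) p) ↔
    extD (gaugeForm (kinetic G) J φ) p = 0 := by
  have hφ' := contDiffAt_base (p := p) (h.contDiffAt_of_contDiffOn hφ hp)
  have hsplit : extD (gaugeForm (kinetic G) J φ) p =
      extD (lieDerivForm (lagrangeField (kinetic G)) (thetaOne (kinetic G) J)) p -
        extD (fun q => kinetic G q • fderiv ℝ (fun q : E × E => φ q.1) q) p :=
    extD_sub (lieDerivForm_contDiffAt (h.contDiffAt_lagrangeField hp)
      (h.contDiffAt_thetaOne hJ hp)).diff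
      ((h.contDiffAt_kinetic hp).smul (hφ'.fderiv_right (m := ∞) (by simp))).diff
  have hrhs : ∀ ξ η, omega (kinetic G) p
      (fderiv ℝ (fun q : E × E => φ q.1) p ξ • lagrangeField (kinetic G) p -
        fderiv ℝ (energy (kinetic G)) p ξ • hamField (kinetic G) (fun q => φ q.1) p) η =
      extD (fun q => kinetic G q • fderiv ℝ (fun q : E × E => φ q.1) q) p ξ η := fun ξ η => by
    rw [extD_smul_fderiv (h.contDiffAt_kinetic hp).diff hφ', map_sub, map_smul, map_smul,
      lagrangeField, hamField, hamField, apply_sharp (h.isInvertible_omega hp),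
      apply_sharp (h.isInvertible_omega hp), (h.energy_eventuallyEq hp).fderiv_eq]
    simp
    ring
  rw [hsplit, sub_eq_zero]
  constructor
  · intro H
    refine ContinuousLinearMap.ext fun ξ => ContinuousLinearMap.ext fun η => ?_
    rw [← hrhs, ← H, h.omega_lieDerivTensor hJ hp]
  · intro H ξ
    apply (h.isInvertible_omega hp).injective
    refine ContinuousLinearMap.ext fun η => ?_
    rw [hrhs, h.omega_lieDerivTensor hJ hp, H]

theorem gaugeForm_apply (hJ : ContDiffOn ℝ ∞ J U) (hφ : ContDiffOn ℝ ∞ φ U) {p : E × E}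
    (hp : p.1 ∈ U) (ξ : E × E) :
    gaugeForm (kinetic G) J φ p ξ =
      G p.1 p.2 (covEndo G J p.1 p.2 ξ.1) + G p.1 p.2 (J p.1 (ξ.2 + chr G p.1 p.2 ξ.1)) -
        1 / 2 * G p.1 p.2 p.2 * fderiv ℝ φ p.1 ξ.1 := by
  have e : fderiv ℝ (thetaOne (kinetic G) J) p (lagrangeField (kinetic G) p) ξ =
      G p.1 p.2 (covEndo G J p.1 p.2 ξ.1) + G p.1 p.2 (J p.1 (chr G p.1 p.2 ξ.1)) := by
    have e1 : fderiv ℝ (thetaOne (kinetic G) J) p (lagrangeField (kinetic G) p) ξ =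
        fderiv ℝ (fun q : E × E => (G q.1 q.2).comp (J q.1)) p
          (lagrangeField (kinetic G) p) ξ.1 := by
      rw [(h.thetaOne_eventuallyEq hp).fderiv_eq,
        ((h.contDiffAt_thetaComp hJ hp).diff.hasFDerivAt.clm_comp (hasFDerivAt_const _ p)).fderiv]
      simp
    rw [e1, h.fderiv_thetaComp hJ hp, h.lagrangeField_eq hp]
    simp
  simp only [gaugeForm, lieDerivForm, sub_apply, add_apply, smul_apply, smul_eq_mul,
    ContinuousLinearMap.comp_apply, e, h.fderiv_lagrangeField hp, h.thetaOne_eq hp,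
    fderiv_base (h.contDiffAt_of_contDiffOn hφ hp).diff]
  simp [kinetic]
  ring

/-- For symmetric `J`, the form `𝓛_Γ (dL ∘ Jᶜ ∘ S) - L df` differs from the differential of
`½ g(u, J u)` by the semi-basic form `(∇_u J)(u, ·) - ½ (∇_· J)(u, u) - L df`. -/
theorem gaugeForm_sub_fderiv (hJ : ContDiffOn ℝ ∞ J U) (hφ : ContDiffOn ℝ ∞ φ U)
    {p : E × E} (hp : p.1 ∈ U) (hs : ∀ a b, G p.1 (J p.1 a) b = G p.1 a (J p.1 b)) (ξ : E × E) :
    gaugeForm (kinetic G) J φ p ξ -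
        fderiv ℝ (fun q : E × E => (1 / 2 : ℝ) • ((G q.1 q.2).comp (J q.1)) q.2) p ξ =
      G p.1 p.2 (covEndo G J p.1 p.2 ξ.1) - 1 / 2 * G p.1 p.2 (covEndo G J p.1 ξ.1 p.2) -
        1 / 2 * G p.1 p.2 p.2 * fderiv ℝ φ p.1 ξ.1 := by
  have hA := (h.contDiffAt_thetaComp hJ hp).diff
  rw [h.gaugeForm_apply hJ hφ hp, fderiv_fun_const_smul (hA.clm_apply differentiableAt_snd),
    fderiv_clm_apply hA differentiableAt_snd]
  have e := h.fderiv_thetaComp hJ hp ξ p.2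
  have hs' : ∀ a, G p.1 a (J p.1 p.2) = G p.1 p.2 (J p.1 a) := fun a => by
    rw [← hs, h.symm _ hp]
  simp [e, fderiv_snd, hs', h.chr_symm hp ξ.1 p.2]
  ring

end IsLocalMetric

/-! ### The special conformal Killing equation -/

theorem covEndo_add_left (G : E → E →L[ℝ] E →L[ℝ] ℝ) (J : E → E →L[ℝ] E) (x c d a : E) :
    covEndo G J x (c + d) a = covEndo G J x c a + covEndo G J x d a := by
  simp only [covEndo, map_add, add_apply]
  abel

theorem covEndo_add_right (G : E → E →L[ℝ] E →L[ℝ] ℝ) (J : E → E →L[ℝ] E) (x c a b : E) :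
    covEndo G J x c (a + b) = covEndo G J x c a + covEndo G J x c b := by
  simp only [covEndo, map_add]
  abel

theorem lowered_apply (G : E → E →L[ℝ] E →L[ℝ] ℝ) (J : E → E →L[ℝ] E) (x a b : E) :
    lowered G J x a b = G x a (J x b) := rfl

namespace IsLocalMetric

variable {G : E → E →L[ℝ] E →L[ℝ] ℝ} {J : E → E →L[ℝ] E} {φ : E → ℝ} {U : Set E}
  (h : IsLocalMetric G U)
include h

theorem hasFDerivAt_lowered (hJ : ContDiffOn ℝ ∞ J U) {x : E} (hx : x ∈ U) :
    DifferentiableAt ℝ (lowered G J) x ∧ ∀ c a b, fderiv ℝ (lowered G J) x c a b =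
      fderiv ℝ G x c a (J x b) + G x a (fderiv ℝ J x c b) := by
  have hG := (h.contDiffAt hx).diff.hasFDerivAt
  have hJ' := (h.contDiffAt_of_contDiffOn hJ hx).diff.hasFDerivAt
  have e : lowered G J = fun y => flipCLM E ((flipCLM E (G y)).comp (J y)) := by
    ext y a b
    rfl
  have h1 : HasFDerivAt (fun y => flipCLM E (G y)) _ x := (flipCLM E).hasFDerivAt.comp x hG
  have h2 : HasFDerivAt (fun y => flipCLM E ((flipCLM E (G y)).comp (J y))) _ x :=
    (flipCLM E).hasFDerivAt.comp x (h1.clm_comp hJ')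
  rw [e]
  refine ⟨h2.differentiableAt, fun c a b => ?_⟩
  rw [h2.fderiv]
  simp [flipCLM, add_comm]

variable [FiniteDimensional ℝ E]

theorem covDerivForm_lowered (hJ : ContDiffOn ℝ ∞ J U) {x : E} (hx : x ∈ U) (c a b : E) :
    covDerivForm G (lowered G J) x c a b = G x a (covEndo G J x c b) := by
  simp only [covDerivForm, (h.hasFDerivAt_lowered hJ hx).2, lowered_apply, ← chr_apply,
    h.fderiv_eq hx, covEndo, map_add, map_sub]
  ring

theorem apply_covEndo_symm (hJ : ContDiffOn ℝ ∞ J U)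
    (hs : ∀ x ∈ U, ∀ a b, G x (J x a) b = G x a (J x b)) {x : E} (hx : x ∈ U) (c a b : E) :
    G x a (covEndo G J x c b) = G x b (covEndo G J x c a) := by
  have hK : ∀ y ∈ U, ∀ a b, lowered G J y a b = lowered G J y b a := fun y hy a b => by
    rw [lowered_apply, lowered_apply, ← hs y hy, h.symm y hy]
  rw [← h.covDerivForm_lowered hJ hx, ← h.covDerivForm_lowered hJ hx, covDerivForm, covDerivForm,
    fderiv_bilin_symm (h.hasFDerivAt_lowered hJ hx).1
      (Filter.mem_of_superset (h.mem_nhds hx) hK) c a b, hK x hx _ b, hK x hx a]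
  ring

/-- The vertical-vertical components of the differential are `G(a, J b) - G(b, J a)`. -/
theorem isSymmetric_of_gauge (hJ : ContDiffOn ℝ ∞ J U) (hφ : ContDiffOn ℝ ∞ φ U) {x : E}
    (hx : x ∈ U) (H : extD (gaugeForm (kinetic G) J φ) (x, 0) = 0) (a b : E) :
    G x (J x a) b = G x a (J x b) := by
  have hp : ((x, 0) : E × E).1 ∈ U := hx
  have e : ∀ a b : E, fderiv ℝ (gaugeForm (kinetic G) J φ) (x, 0) (0, a) (0, b) =
      G x a (J x b) := fun a b => by
    have e1 : (fun q => gaugeForm (kinetic G) J φ q (0, b)) =ᶠ[𝓝 ((x, 0) : E × E)]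
        fun q => ((G q.1 q.2).comp (J q.1)) b := by
      filter_upwards [h.eventually hp] with q hq
      rw [h.gaugeForm_apply hJ hφ hq]
      simp [covEndo]
    rw [fderiv_apply_const (h.contDiffAt_gaugeForm hJ hφ hp).diff, e1.fderiv_eq,
      ← fderiv_apply_const (h.contDiffAt_thetaComp hJ hp).diff, h.fderiv_thetaComp hJ hp]
    simp
  have := congrArg (fun T : E × E →L[ℝ] E × E →L[ℝ] ℝ => T (0, a) (0, b)) H
  simp only [extD_apply, e, zero_apply] at this
  rw [h.symm x hx, sub_eq_zero.1 this]

/-- Subtracting the exact form `d(½ G(u, J u))` does not change the differential. -/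
theorem extD_gaugeForm_eq (hJ : ContDiffOn ℝ ∞ J U) (hφ : ContDiffOn ℝ ∞ φ U)
    {p : E × E} (hp : p.1 ∈ U) :
    extD (fun q => gaugeForm (kinetic G) J φ q -
      fderiv ℝ (fun q : E × E => (1 / 2 : ℝ) • ((G q.1 q.2).comp (J q.1)) q.2) q) p =
    extD (gaugeForm (kinetic G) J φ) p := by
  have hN : ContDiffAt ℝ ∞
      (fun q : E × E => (1 / 2 : ℝ) • ((G q.1 q.2).comp (J q.1)) q.2) p :=
    ((h.contDiffAt_thetaComp hJ hp).clm_apply contDiffAt_snd).const_smul _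
  rw [extD_sub (h.contDiffAt_gaugeForm hJ hφ hp).diff hN.differentiableAt_fderiv, extD_fderiv hN,
    sub_zero]

/-- The special conformal Killing equation makes `𝓛_Γ (dL ∘ Jᶜ ∘ S) - L df` equal to
`d(½ G(u, J u))`. -/
theorem gauge_of_sckAt (hJ : ContDiffOn ℝ ∞ J U) (hφ : ContDiffOn ℝ ∞ φ U)
    (hs : ∀ x ∈ U, ∀ a b, G x (J x a) b = G x a (J x b)) (hK : ∀ x ∈ U, SCKAt G J φ x)
    {p : E × E} (hp : p.1 ∈ U) : extD (gaugeForm (kinetic G) J φ) p = 0 := by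
  rw [← h.extD_gaugeForm_eq hJ hφ hp]
  have e : (fun q => gaugeForm (kinetic G) J φ q -
      fderiv ℝ (fun q : E × E => (1 / 2 : ℝ) • ((G q.1 q.2).comp (J q.1)) q.2) q) =ᶠ[𝓝 p]
      fun _ => 0 := by
    filter_upwards [h.eventually hp] with q hq
    refine ContinuousLinearMap.ext fun ξ => ?_
    rw [sub_apply, h.gaugeForm_sub_fderiv hJ hφ hq (hs _ hq), hK _ hq, hK _ hq,
      h.symm _ hq ξ.1 q.2, zero_apply]
    ring
  rw [extD_congr e]
  simp [extD]

/-- If `𝓛_Γ (dL ∘ Jᶜ ∘ S) - L df` is closed, then its difference from `d(½ G(u, J u))` is closed,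
semi-basic and quadratic in `u`, hence zero; the equation is its polarisation. -/
theorem sckAt_of_gauge (hJ : ContDiffOn ℝ ∞ J U) (hφ : ContDiffOn ℝ ∞ φ U)
    (H : ∀ p : E × E, p.1 ∈ U → extD (gaugeForm (kinetic G) J φ) p = 0) {x : E} (hx : x ∈ U) :
    SCKAt G J φ x := by
  have hs : ∀ x ∈ U, ∀ a b, G x (J x a) b = G x a (J x b) := fun x hx =>
    h.isSymmetric_of_gauge hJ hφ hx (H _ hx)
  obtain ⟨γ, hγ⟩ : ∃ γ : E × E → E × E →L[ℝ] ℝ, γ = fun q => gaugeForm (kinetic G) J φ q -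
      fderiv ℝ (fun q : E × E => (1 / 2 : ℝ) • ((G q.1 q.2).comp (J q.1)) q.2) q := ⟨_, rfl⟩
  have hγd : ∀ p : E × E, p.1 ∈ U → DifferentiableAt ℝ γ p := fun p hp => by
    rw [hγ]
    exact (h.contDiffAt_gaugeForm hJ hφ hp).diff.sub (ContDiffAt.differentiableAt_fderiv
      (((h.contDiffAt_thetaComp hJ hp).clm_apply contDiffAt_snd).const_smul _))
  have hγa : ∀ p : E × E, p.1 ∈ U → ∀ ξ, γ p ξ =
      G p.1 p.2 (covEndo G J p.1 p.2 ξ.1) - 1 / 2 * G p.1 p.2 (covEndo G J p.1 ξ.1 p.2) -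
        1 / 2 * G p.1 p.2 p.2 * fderiv ℝ φ p.1 ξ.1 := fun p hp ξ => by
    rw [hγ]
    exact h.gaugeForm_sub_fderiv hJ hφ hp (hs _ hp) ξ
  -- As `γ` is semi-basic and closed, its vertical derivatives vanish.
  have hγv : ∀ p : E × E, p.1 ∈ U → ∀ a b : E, fderiv ℝ γ p (0, b) (a, 0) = 0 := fun p hp a b => by
    have e1 : extD γ p (0, b) (a, 0) = 0 := by
      rw [hγ, h.extD_gaugeForm_eq hJ hφ hp, H p hp]
      rfl
    have e2 : (fun q => γ q (0, b)) =ᶠ[𝓝 p] fun _ => 0 := by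
      filter_upwards [h.eventually hp] with q hq
      rw [hγa q hq]
      simp [covEndo]
    rw [extD_apply, fderiv_apply_const (hγd p hp) (a, 0), e2.fderiv_eq] at e1
    simpa using e1
  -- Hence `γ (x, ·)` is constant on the fibre, and it is zero at `u = 0`.
  have hzero : ∀ u a : E, G x u (covEndo G J x u a) - 1 / 2 * G x u (covEndo G J x a u) -
      1 / 2 * G x u u * fderiv ℝ φ x a = 0 := fun u a => by
    have hd : ∀ v : E, HasFDerivAt (fun v : E => γ (x, v) (a, 0)) (0 : E →L[ℝ] ℝ) v := fun v => by
      have h1 := (hγd (x, v) hx).hasFDerivAt.comp v (hasFDerivAt_prodMk_right x v)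
      have h2 := h1.clm_apply (hasFDerivAt_const ((a, 0) : E × E) v)
      refine h2.congr_fderiv ?_
      ext b
      simp [hγv (x, v) hx]
    have hc := is_const_of_fderiv_eq_zero (𝕜 := ℝ) (fun v => (hd v).differentiableAt)
      (fun v => (hd v).fderiv) u 0
    rw [hγa _ hx, hγa _ hx] at hc
    simpa using hc
  have hpol : ∀ u v a : E, G x u (covEndo G J x v a) + G x v (covEndo G J x u a) -
      G x u (covEndo G J x a v) = G x u v * fderiv ℝ φ x a := fun u v a => by
    have h1 := hzero (u + v) a
    have h2 := hzero u a
    have h3 := hzero v a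
    have h4 := h.apply_covEndo_symm hJ hs hx a u v
    simp only [covEndo_add_left, covEndo_add_right, map_add, add_apply, h.symm x hx v u]
      at h1
    linarith
  -- Koszul's trick: of the six terms in `hpol c a b + hpol c b a` only `2 (∇_c J)(a, b)` survives.
  intro c a b
  have h1 := hpol c a b
  have h2 := hpol c b a
  have h3 := h.apply_covEndo_symm hJ hs hx a c b
  have h4 := h.apply_covEndo_symm hJ hs hx b c a
  have h5 := h.apply_covEndo_symm hJ hs hx c a b
  rw [h.symm x hx c a] at h1
  rw [h.symm x hx c b] at h2
  linarith

/-- `R = Jᶜ - Δ ⊗ df` for special conformal Killing tensors: both sides have the same contraction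
with `ω_L`. -/
theorem recursionTensor_eq (hJ : ContDiffOn ℝ ∞ J U)
    (hs : ∀ x ∈ U, ∀ a b, G x (J x a) b = G x a (J x b)) {p : E × E} (hp : p.1 ∈ U)
    (hK : SCKAt G J φ p.1) (ξ : E × E) :
    recursionTensor (kinetic G) J p ξ =
      completeLift J p ξ - fderiv ℝ φ p.1 ξ.1 • liouville p := by
  have hv : (completeLift J p ξ - fderiv ℝ φ p.1 ξ.1 • liouville p).2 +
      chr G p.1 p.2 (completeLift J p ξ - fderiv ℝ φ p.1 ξ.1 • liouville p).1 =
      J p.1 (ξ.2 + chr G p.1 p.2 ξ.1) + covEndo G J p.1 p.2 ξ.1 -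
        fderiv ℝ φ p.1 ξ.1 • p.2 := by
    simp [completeLift, liouville, covEndo]
    abel
  have hf : (completeLift J p ξ - fderiv ℝ φ p.1 ξ.1 • liouville p).1 = J p.1 ξ.1 := by
    simp [completeLift, liouville]
  apply (h.isInvertible_omega hp).injective
  refine ContinuousLinearMap.ext fun η => ?_
  rw [h.apply_recursionTensor hp, h.omegaOne_apply hJ hp, h.omega_apply_eq hp, hv, hf, hK, hK]
  have e := hK p.2 η.1 ξ.1
  rw [h.symm _ hp] at e
  simp only [map_add, map_sub, map_smul, add_apply, sub_apply, smul_apply, hs _ hp, smul_eq_mul, e]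
  rw [h.symm _ hp p.2 η.1, h.symm _ hp p.2 ξ.1, h.symm _ hp ξ.1 η.1]
  ring

end IsLocalMetric

/-! ### Objects along the projection -/

theorem vertPart_add (Γ : E × E → E × E) (p ξ η : E × E) :
    vertPart Γ p (ξ + η) = vertPart Γ p ξ + vertPart Γ p η := by
  simp only [vertPart, Prod.snd_add, Prod.fst_add, map_add]
  abel

theorem vertPart_sub (Γ : E × E → E × E) (p ξ η : E × E) :
    vertPart Γ p (ξ - η) = vertPart Γ p ξ - vertPart Γ p η := by
  simp only [vertPart, Prod.snd_sub, Prod.fst_sub, map_sub]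
  abel

theorem vertPart_hLift (Γ : E × E → E × E) (p : E × E) (a : E) :
    vertPart Γ p (hLift Γ p a) = 0 := by
  simp [vertPart, hLift]

theorem vertPart_vLift (Γ : E × E → E × E) (p : E × E) (a : E) :
    vertPart Γ p (vLift a) = a := by
  simp [vertPart, vLift]

theorem eq_hLift_add_vLift (Γ : E × E → E × E) (p ξ : E × E) :
    ξ = hLift Γ p ξ.1 + vLift (vertPart Γ p ξ) := by
  ext <;> simp [hLift, vLift, vertPart]

namespace IsLocalMetric

variable {G : E → E →L[ℝ] E →L[ℝ] ℝ} {J : E → E →L[ℝ] E} {φ : E → ℝ} {U : Set E}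
  (h : IsLocalMetric G U) [FiniteDimensional ℝ E]
include h

/-- The non-linear connection of the geodesic spray is the Levi-Civita connection. -/
theorem connection_eq {p : E × E} (hp : p.1 ∈ U) :
    connection (lagrangeField (kinetic G)) p = chr G p.1 p.2 := by
  ext a
  simp [connection, vLift, h.fderiv_lagrangeField hp, two_smul, ← add_smul]
  norm_num

theorem hLift_apply {p : E × E} (hp : p.1 ∈ U) (a : E) :
    hLift (lagrangeField (kinetic G)) p a = (a, -chr G p.1 p.2 a) := by
  simp [hLift, h.connection_eq hp]

theorem vertPart_apply {p : E × E} (hp : p.1 ∈ U) (ξ : E × E) :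
    vertPart (lagrangeField (kinetic G)) p ξ = ξ.2 + chr G p.1 p.2 ξ.1 := by
  simp [vertPart, h.connection_eq hp]

theorem contDiffAt_hLift {p : E × E} (hp : p.1 ∈ U) :
    ContDiffAt ℝ ∞ (hLift (lagrangeField (kinetic G))) p := by
  have : hLift (lagrangeField (kinetic G)) =ᶠ[𝓝 p]
      fun q => (ContinuousLinearMap.inl ℝ E E) -
        (ContinuousLinearMap.inr ℝ E E).comp (chr G q.1 q.2) := by
    filter_upwards [h.eventually hp] with q hq
    ext a <;> simp [h.hLift_apply hq]
  exact (contDiffAt_const.sub (contDiffAt_const.clm_comp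
    ((contDiffAt_base (h.contDiffAt_chr hp)).clm_apply contDiffAt_snd))).congr_of_eventuallyEq this

theorem bracket_vLift {W : E × E → E} {p : E × E} (hp : p.1 ∈ U) (hW : DifferentiableAt ℝ W p) :
    VectorField.lieBracket ℝ (lagrangeField (kinetic G)) (fun q => vLift (W q)) p =
      (-W p, fderiv ℝ W p (lagrangeField (kinetic G) p) + 2 • chr G p.1 p.2 (W p)) := by
  have e : fderiv ℝ (fun q => (vLift (W q) : E × E)) p = (vLift (E := E)).comp (fderiv ℝ W p) :=
    ((vLift (E := E)).hasFDerivAt.comp p hW.hasFDerivAt).fderiv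
  rw [VectorField.lieBracket, e, h.fderiv_lagrangeField hp]
  simp [vLift]

theorem dynCov_eq {W : E × E → E} {p : E × E} (hp : p.1 ∈ U) (hW : DifferentiableAt ℝ W p) :
    dynCov (lagrangeField (kinetic G)) W p =
      fderiv ℝ W p (lagrangeField (kinetic G) p) + chr G p.1 p.2 (W p) := by
  rw [dynCov, h.bracket_vLift hp hW, h.vertPart_apply hp]
  simp [two_smul]
  abel

theorem dynCov_const {p : E × E} (hp : p.1 ∈ U) (X : E) :
    dynCov (lagrangeField (kinetic G)) (fun _ => X) p = chr G p.1 p.2 X := by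
  rw [h.dynCov_eq hp (differentiableAt_const X)]
  simp

/-- On basic tensor fields the dynamical covariant derivative is the Levi-Civita derivative in the
direction `u`. -/
theorem dynCovTensor_eq (hJ : ContDiffOn ℝ ∞ J U) {p : E × E} (hp : p.1 ∈ U) (X : E) :
    dynCovTensor (lagrangeField (kinetic G)) (fun q => J q.1) p X = covEndo G J p.1 p.2 X := by
  have hJ' := (h.contDiffAt_of_contDiffOn hJ hp).diff
  have hb := (hasFDerivAt_base hJ').differentiableAt
  rw [dynCovTensor, h.dynCov_const hp, h.dynCov_eq hp (hb.clm_apply (differentiableAt_const X)),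
    ← fderiv_apply_const hb, fderiv_base hJ', h.lagrangeField_eq hp, covEndo]

theorem dH_apply (hφ : ContDiffOn ℝ ∞ φ U) {p : E × E} (hp : p.1 ∈ U) (X : E) :
    dH (lagrangeField (kinetic G)) φ p X = fderiv ℝ φ p.1 X := by
  rw [dH, ContinuousLinearMap.comp_apply, fderiv_base (h.contDiffAt_of_contDiffOn hφ hp).diff,
    h.hLift_apply hp]

theorem xField_eq (hφ : ContDiffOn ℝ ∞ φ U) {p : E × E} (hp : p.1 ∈ U) :
    xField G (kinetic G) φ p = -sharp (G p.1) (fderiv ℝ φ p.1) := by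
  have e : dH (lagrangeField (kinetic G)) φ p = fderiv ℝ φ p.1 :=
    ContinuousLinearMap.ext fun X => h.dH_apply hφ hp X
  rw [xField, e, sharp, sharp, map_neg]

theorem apply_xField (hφ : ContDiffOn ℝ ∞ φ U) {p : E × E} (hp : p.1 ∈ U) (b : E) :
    G p.1 (xField G (kinetic G) φ p) b = -fderiv ℝ φ p.1 b := by
  rw [h.xField_eq hφ hp, map_neg, apply_sharp (h.isInvertible hp)]
  rfl

theorem contDiffAt_xField (hφ : ContDiffOn ℝ ∞ φ U) {p : E × E} (hp : p.1 ∈ U) :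
    ContDiffAt ℝ ∞ (xField G (kinetic G) φ) p := by
  have : CompleteSpace E := FiniteDimensional.complete ℝ E
  have hI : ContDiffAt ℝ ∞ (fun y => (G y).inverse) p.1 :=
    ((h.isInvertible hp).contDiffAt_map_inverse).comp p.1 (h.contDiffAt hp)
  have hD : ContDiffAt ℝ ∞ (fderiv ℝ φ) p.1 :=
    (h.contDiffAt_of_contDiffOn hφ hp).fderiv_right (m := ∞) (by simp)
  exact (contDiffAt_base (hI.clm_apply hD).neg).congr_of_eventuallyEq
    ((h.eventually hp).mono fun q hq => h.xField_eq hφ hq)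

/-- The special conformal Killing equation, contracted with `u` and with an index raised. -/
theorem sckAt_iff (hφ : ContDiffOn ℝ ∞ φ U) {x : E} (hx : x ∈ U) :
    SCKAt G J φ x ↔ ∀ u X : E, covEndo G J x u X =
      (1 / 2 : ℝ) • (fderiv ℝ φ x X • u - G x u X • xField G (kinetic G) φ (x, u)) := by
  have key : ∀ u X a : E,
      G x a ((1 / 2 : ℝ) • (fderiv ℝ φ x X • u - G x u X • xField G (kinetic G) φ (x, u))) =
        1 / 2 * (G x a u * fderiv ℝ φ x X + G x X u * fderiv ℝ φ x a) := fun u X a => by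
    have e : G x a (xField G (kinetic G) φ (x, u)) = -fderiv ℝ φ x a := by
      rw [h.symm x hx]
      exact h.apply_xField hφ (p := (x, u)) hx a
    rw [map_smul, map_sub, map_smul, map_smul, e, h.symm x hx u X]
    simp only [smul_eq_mul]
    ring
  constructor
  · intro H u X
    refine sub_eq_zero.1 (h.nondegenerate x hx _ fun a => ?_)
    rw [h.symm x hx, map_sub, H, key, sub_self]
  · intro H c a b
    rw [H, key]

theorem horCovConst_apply {p : E × E} (hp : p.1 ∈ U) (X Y : E) :
    horCovConst (lagrangeField (kinetic G)) p X Y = chr G p.1 Y X := by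
  have e : connection (lagrangeField (kinetic G)) =ᶠ[𝓝 p] fun q => chr G q.1 q.2 :=
    (h.eventually hp).mono fun q hq => h.connection_eq hq
  have : horCovConst (lagrangeField (kinetic G)) p X Y =
      fderiv ℝ (connection (lagrangeField (kinetic G))) p (0, Y) X := rfl
  rw [this, e.fderiv_eq, fderiv_linear (h.contDiffAt_chr hp).diff]
  simp

theorem horCovForm_apply (hJ : ContDiffOn ℝ ∞ J U) {p : E × E} (hp : p.1 ∈ U) (X Y : E) :
    horCovForm (lagrangeField (kinetic G)) (fun q => (theta (kinetic G) q).comp (J q.1)) p X Y =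
      G p.1 p.2 (covEndo G J p.1 X Y) := by
  have e : (fun q : E × E => (theta (kinetic G) q).comp (J q.1)) =ᶠ[𝓝 p]
      fun q => (G q.1 q.2).comp (J q.1) :=
    (h.eventually hp).mono fun q hq => by simp only [h.theta_eq hq]
  simp only [horCovForm, sub_apply, ContinuousLinearMap.comp_apply,
    ContinuousLinearMap.compL_apply, e.fderiv_eq, h.fderiv_thetaComp hJ hp, h.hLift_apply hp,
    h.horCovConst_apply hp, h.theta_eq hp, h.chr_symm hp Y X]
  simp

theorem uTensor_eq (hJ : ContDiffOn ℝ ∞ J U) (hφ : ContDiffOn ℝ ∞ φ U) {p : E × E}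
    (hp : p.1 ∈ U) (hK : SCKAt G J φ p.1) (X : E) :
    uTensor G (kinetic G) J p X = -((1 / 2 : ℝ) • (fderiv ℝ φ p.1 X • p.2 +
      G p.1 p.2 X • xField G (kinetic G) φ p)) := by
  refine sharp_eq (h.isInvertible hp) fun Y => ?_
  have e : ∀ X Y, G p.1 p.2 (covEndo G J p.1 X Y) =
    1 / 2 * (G p.1 p.2 X * fderiv ℝ φ p.1 Y + G p.1 Y X * fderiv ℝ φ p.1 p.2) :=
    fun X Y => hK X p.2 Y
  simp only [dHForm, sub_apply, ContinuousLinearMap.flip_apply, h.horCovForm_apply hJ hp, e,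
    map_neg, map_smul, map_add, neg_apply, smul_apply, add_apply, h.apply_xField hφ hp,
    smul_eq_mul, h.symm _ hp Y X]
  ring

/-- `[Γ, Xᴴ] = (∇X)ᴴ + Φ(X)ⱽ` for vector fields along the projection. -/
theorem bracket_hLift {W : E × E → E} {p : E × E} (hp : p.1 ∈ U) (hW : DifferentiableAt ℝ W p) :
    VectorField.lieBracket ℝ (lagrangeField (kinetic G))
        (fun q => hLift (lagrangeField (kinetic G)) q (W q)) p =
      hLift (lagrangeField (kinetic G)) p (dynCov (lagrangeField (kinetic G)) W p) +
        vLift (jacobiEndo (lagrangeField (kinetic G)) p (W p)) := by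
  have hH := (h.contDiffAt_hLift hp).diff
  have e1 : VectorField.lieBracket ℝ (lagrangeField (kinetic G))
        (fun q => hLift (lagrangeField (kinetic G)) q (W q)) p =
      VectorField.lieBracket ℝ (lagrangeField (kinetic G))
        (fun q => hLift (lagrangeField (kinetic G)) q (W p)) p +
      hLift (lagrangeField (kinetic G)) p (fderiv ℝ W p (lagrangeField (kinetic G) p)) := by
    simp only [VectorField.lieBracket, fderiv_clm_apply hH hW,
      fderiv_clm_apply hH (differentiableAt_const (W p))]
    simp
    abel
  have e2 : (VectorField.lieBracket ℝ (lagrangeField (kinetic G))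
        (fun q => hLift (lagrangeField (kinetic G)) q (W p)) p).1 = chr G p.1 p.2 (W p) := by
    have hd : DifferentiableAt ℝ (fun q => hLift (lagrangeField (kinetic G)) q (W p)) p :=
      hH.clm_apply (differentiableAt_const _)
    have e3 : (fderiv ℝ (fun q => hLift (lagrangeField (kinetic G)) q (W p)) p
        (lagrangeField (kinetic G) p)).1 = 0 := by
      have e4 := (hasFDerivAt_fst.comp p hd.hasFDerivAt).fderiv
      have e5 : (Prod.fst ∘ fun q => hLift (lagrangeField (kinetic G)) q (W p)) = fun _ => W p := by
        ext q
        simp [hLift]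
      rw [e5] at e4
      have := congrArg (fun T : E × E →L[ℝ] E => T (lagrangeField (kinetic G) p)) e4
      simpa using this.symm
    rw [VectorField.lieBracket, Prod.fst_sub, e3, h.fderiv_lagrangeField hp, h.hLift_apply hp]
    simp
  rw [e1, eq_hLift_add_vLift (lagrangeField (kinetic G)) p
    (VectorField.lieBracket ℝ (lagrangeField (kinetic G)) _ p), e2, h.dynCov_eq hp hW, jacobiEndo,
    map_add]
  abel

/-- The commutator of the Jacobi endomorphism with a special conformal Killing tensor: the
vertical component of `𝓛_Γ R = Γ ⊗ df - ξ_f ⊗ dE_L` on horizontal fields. -/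
theorem jacobiEndo_commutator (hJ : ContDiffOn ℝ ∞ J U) (hφ : ContDiffOn ℝ ∞ φ U)
    (hs : ∀ x ∈ U, ∀ a b, G x (J x a) b = G x a (J x b)) (hK : ∀ x ∈ U, SCKAt G J φ x)
    {p : E × E} (hp : p.1 ∈ U) (X : E) :
    jacobiEndo (lagrangeField (kinetic G)) p (J p.1 X) -
        J p.1 (jacobiEndo (lagrangeField (kinetic G)) p X) =
      (1 / 2 : ℝ) • (dynCovForm (lagrangeField (kinetic G))
          (dH (lagrangeField (kinetic G)) φ) p X • p.2 +
        G p.1 p.2 X • dynCov (lagrangeField (kinetic G)) (xField G (kinetic G) φ) p) := by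
  obtain ⟨Γ, hΓ⟩ : ∃ Γ, Γ = lagrangeField (kinetic G) := ⟨_, rfl⟩
  obtain ⟨xf, hxf⟩ : ∃ xf, xf = xField G (kinetic G) φ := ⟨_, rfl⟩
  obtain ⟨W, hW⟩ : ∃ W : E × E → E, W = fun q => -((1 / 2 : ℝ) • (fderiv ℝ φ q.1 X • q.2 +
    G q.1 q.2 X • xf q)) := ⟨_, rfl⟩
  rw [← hΓ, ← hxf]
  have hΓp : Γ p = (p.2, -chr G p.1 p.2 p.2) := by rw [hΓ, h.lagrangeField_eq hp]
  have hG := (h.contDiffAt hp).diff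
  have hJ' := (h.contDiffAt_of_contDiffOn hJ hp).diff
  have hJb := (hasFDerivAt_base hJ').differentiableAt
  have hφ1 := (h.contDiffAt_of_contDiffOn hφ hp).differentiableAt_fderiv
  have hxd : DifferentiableAt ℝ xf p := by
    rw [hxf]
    exact (h.contDiffAt_xField hφ hp).diff
  have hdφX : DifferentiableAt ℝ (fun q : E × E => fderiv ℝ φ q.1 X) p :=
    (hasFDerivAt_base hφ1).differentiableAt.clm_apply (differentiableAt_const X)
  have hGu : DifferentiableAt ℝ (fun q : E × E => G q.1 q.2) p :=
    ((hasFDerivAt_base hG).clm_apply hasFDerivAt_snd).differentiableAt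
  have hθX : DifferentiableAt ℝ (fun q : E × E => G q.1 q.2 X) p :=
    hGu.clm_apply (differentiableAt_const X)
  have hWd : DifferentiableAt ℝ W p := by
    rw [hW]
    exact (((hdφX.smul differentiableAt_snd).add (hθX.smul hxd)).const_smul _).neg
  -- `R Xᴴ = (J X)ᴴ + (U X)ⱽ`
  have hR : (fun q => recursionTensor (kinetic G) J q (hLift Γ q X)) =ᶠ[𝓝 p]
      ((fun q => hLift Γ q (J q.1 X)) + fun q => vLift (W q)) := by
    filter_upwards [h.eventually hp] with q hq
    have hc := (h.sckAt_iff hφ hq).1 (hK _ hq) q.2 X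
    rw [← hxf, covEndo, sub_eq_iff_eq_add, ← eq_sub_iff_add_eq] at hc
    rw [Pi.add_apply, h.recursionTensor_eq hJ hs hq (hK _ hq), hΓ, h.hLift_apply hq,
      h.hLift_apply hq, hW]
    ext
    · simp [completeLift, liouville, vLift]
    · simp [completeLift, liouville, vLift, hc]
      module
  have hgauge := (h.gaugedInvariance_iff hJ hφ hp).2 (h.gauge_of_sckAt hJ hφ hs hK hp)
    (hLift Γ p X)
  -- The energy is constant along horizontal fields, because the connection is metric.
  have hdE : fderiv ℝ (energy (kinetic G)) p (hLift Γ p X) = 0 := by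
    rw [(h.energy_eventuallyEq hp).fderiv_eq, h.fderiv_kinetic hp, hΓ, h.hLift_apply hp,
      h.fderiv_eq hp, h.chr_symm hp X, h.symm _ hp p.2 (chr G p.1 p.2 X)]
    simp
    rw [h.symm _ hp p.2 (chr G p.1 p.2 X)]
    ring
  have hHd : DifferentiableAt ℝ (fun q => hLift Γ q X) p := by
    rw [hΓ]
    exact (h.contDiffAt_hLift hp).diff.clm_apply (differentiableAt_const X)
  have hHJ : DifferentiableAt ℝ (fun q => hLift Γ q (J q.1 X)) p := by
    rw [hΓ]
    exact (h.contDiffAt_hLift hp).diff.clm_apply (hJb.clm_apply (differentiableAt_const X))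
  have hVd : DifferentiableAt ℝ (fun q => (vLift (W q) : E × E)) p :=
    (vLift (E := E)).differentiableAt.comp p hWd
  rw [hdE, zero_smul, sub_zero, ← hΓ,
    lieDerivTensor_apply_field (h.contDiffAt_recursionTensor hJ hp).diff hHd,
    Filter.EventuallyEq.rfl.lieBracket_vectorField_eq hR,
    VectorField.lieBracket_add_right hHJ hVd, hΓ, h.bracket_hLift hp (differentiableAt_const X),
    h.bracket_hLift hp (hJb.clm_apply (differentiableAt_const X)), h.dynCov_const hp, ← hΓ]
    at hgauge
  have hvert := congrArg (vertPart Γ p) hgauge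
  have hvR : ∀ ξ, vertPart Γ p (recursionTensor (kinetic G) J p ξ) =
      J p.1 (vertPart Γ p ξ) + covEndo G J p.1 p.2 ξ.1 - fderiv ℝ φ p.1 ξ.1 • p.2 := fun ξ => by
    rw [h.recursionTensor_eq hJ hs hp (hK _ hp), hΓ, h.vertPart_apply hp, h.vertPart_apply hp]
    simp [completeLift, liouville, covEndo]
    abel
  have hvΓ : ∀ c : ℝ, vertPart Γ p (c • Γ p) = 0 := fun c => by
    rw [hΓ, h.vertPart_apply hp, h.lagrangeField_eq hp]
    simp
  have hfst : ∀ a b : E, (hLift Γ p a + vLift b : E × E).1 = a := fun a b => by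
    simp [hLift, vLift]
  have hdyn : vertPart Γ p (VectorField.lieBracket ℝ Γ (fun q => vLift (W q)) p) =
    dynCov Γ W p := rfl
  rw [vertPart_sub, hvR, vertPart_add, vertPart_add, vertPart_add, vertPart_hLift, vertPart_hLift,
    vertPart_vLift, vertPart_vLift, hvΓ, hdyn, hfst, (h.sckAt_iff hφ hp).1 (hK _ hp), ← hxf]
    at hvert
  -- The derivative of `G(u, X)` along the spray is `G(u, Γ(u, X))`; this is `∇θ_L = 0`.
  have hDW : fderiv ℝ W p (Γ p) = -((1 / 2 : ℝ) •
      (fderiv ℝ (fun q : E × E => fderiv ℝ φ q.1 X) p (Γ p) • p.2 +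
        fderiv ℝ φ p.1 X • (Γ p).2 + G p.1 p.2 (chr G p.1 p.2 X) • xf p +
        G p.1 p.2 X • fderiv ℝ xf p (Γ p))) := by
    have e1 := (((hdφX.hasFDerivAt.smul hasFDerivAt_snd).add
      (hθX.hasFDerivAt.smul hxd.hasFDerivAt)).const_smul (1 / 2 : ℝ)).neg.fderiv
    have e2 : fderiv ℝ (fun q : E × E => G q.1 q.2 X) p (Γ p) = G p.1 p.2 (chr G p.1 p.2 X) := by
      rw [← fderiv_apply_const hGu, fderiv_linear hG, hΓp, add_apply, h.fderiv_eq hp]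
      simp
    rw [hW]
    refine (congrArg (fun T : E × E →L[ℝ] E => T (Γ p)) e1).trans ?_
    simp [e2]
    module
  have hform : dynCovForm Γ (dH Γ φ) p X =
      fderiv ℝ (fun q : E × E => fderiv ℝ φ q.1 X) p (Γ p) - fderiv ℝ φ p.1 (chr G p.1 p.2 X) := by
    have e1 : (fun q => dH Γ φ q X) =ᶠ[𝓝 p] fun q => fderiv ℝ φ q.1 X := by
      filter_upwards [h.eventually hp] with q hq
      rw [hΓ, h.dH_apply hφ hq]
    rw [dynCovForm, e1.fderiv_eq, hΓ, h.dH_apply hφ hp, h.dynCov_const hp]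
  have hx : dynCov Γ xf p = fderiv ℝ xf p (Γ p) + chr G p.1 p.2 (xf p) := by
    rw [hΓ, h.dynCov_eq hp hxd]
  have hWp : dynCov Γ W p = fderiv ℝ W p (Γ p) + chr G p.1 p.2 (W p) := by
    rw [hΓ, h.dynCov_eq hp hWd]
  have hcW : chr G p.1 p.2 (W p) = -((1 / 2 : ℝ) • (fderiv ℝ φ p.1 X • chr G p.1 p.2 p.2 +
      G p.1 p.2 X • chr G p.1 p.2 (xf p))) := by
    rw [hW]
    simp only [map_neg, map_smul, map_add]
  rw [hWp, hDW, hcW, hΓp] at hvert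
  rw [hform, hx, hΓp]
  simp only [zero_add, Prod.mk.eta] at hvert
  refine sub_eq_zero.1 (Eq.trans ?_ hvert)
  module

end IsLocalMetric

/-! ### Representatives in charts -/

variable {Q : Type*} [TopologicalSpace Q] [ChartedSpace E Q]
  {e : OpenPartialHomeomorph Q E}

theorem mdifferentiable_of_mem_smoothCharts (he : e ∈ smoothCharts E Q) :
    e.MDifferentiable 𝓘(ℝ, E) 𝓘(ℝ, E) :=
  ⟨(contMDiffOn_of_mem_maximalAtlas he).mdifferentiableOn (by simp),
    (contMDiffOn_symm_of_mem_maximalAtlas he).mdifferentiableOn (by simp)⟩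

theorem PseudoMetric.isLocalMetric (g : PseudoMetric E Q) (he : e ∈ smoothCharts E Q) :
    IsLocalMetric (formInChart g.val e) e.target where
  isOpen := e.open_target
  smooth := g.smooth e he
  symm x _ a b := g.symm (e.symm x) _ _
  nondegenerate x hx a ha := by
    have hd := mdifferentiable_of_mem_smoothCharts he
    have h0 := g.nondegenerate (e.symm x) (mfderiv 𝓘(ℝ, E) 𝓘(ℝ, E) e.symm x a) fun b => by
      obtain ⟨b', rfl⟩ := hd.symm.mfderiv_surjective (x := x) hx b
      exact ha b'
    exact hd.symm.mfderiv_injective (x := x) hx (h0.trans (map_zero _).symm)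

theorem mfderiv_symm_tensorInChart (J : EndoField E Q) (he : e ∈ smoothCharts E Q) {x : E}
    (hx : x ∈ e.target) (a : E) :
    mfderiv 𝓘(ℝ, E) 𝓘(ℝ, E) e.symm x (tensorInChart J.val e x a) =
      J.val (e.symm x) (mfderiv 𝓘(ℝ, E) 𝓘(ℝ, E) e.symm x a) := by
  have h := (mdifferentiable_of_mem_smoothCharts he).symm_comp_deriv (e.map_target hx)
  rw [e.right_inv hx] at h
  exact congrArg (fun T : TangentSpace 𝓘(ℝ, E) (e.symm x) →L[ℝ] TangentSpace 𝓘(ℝ, E) (e.symm x) =>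
    T (J.val (e.symm x) (mfderiv 𝓘(ℝ, E) 𝓘(ℝ, E) e.symm x a))) h

theorem isSymmetric_iff [IsManifold 𝓘(ℝ, E) ∞ Q] (g : PseudoMetric E Q) (J : EndoField E Q) :
    IsSymmetric g J ↔ ∀ e ∈ smoothCharts E Q, ∀ x ∈ e.target, ∀ a b,
      formInChart g.val e x (tensorInChart J.val e x a) b =
        formInChart g.val e x a (tensorInChart J.val e x b) := by
  have key : ∀ e ∈ smoothCharts E Q, ∀ x ∈ e.target, ∀ a b : E,
      formInChart g.val e x (tensorInChart J.val e x a) b =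
        formInChart g.val e x a (tensorInChart J.val e x b) ↔
      g.val (e.symm x) (J.val (e.symm x) (mfderiv 𝓘(ℝ, E) 𝓘(ℝ, E) e.symm x a))
          (mfderiv 𝓘(ℝ, E) 𝓘(ℝ, E) e.symm x b) =
        g.val (e.symm x) (mfderiv 𝓘(ℝ, E) 𝓘(ℝ, E) e.symm x a)
          (J.val (e.symm x) (mfderiv 𝓘(ℝ, E) 𝓘(ℝ, E) e.symm x b)) := by
    intro e he x hx a b
    rw [← mfderiv_symm_tensorInChart J he hx, ← mfderiv_symm_tensorInChart J he hx]
    rfl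
  constructor
  · intro H e he x hx a b
    exact (key e he x hx a b).2 (H _ _ _)
  · intro H q a b
    have he : chartAt E q ∈ smoothCharts E Q := IsManifold.chart_mem_maximalAtlas q
    have hd := mdifferentiable_of_mem_smoothCharts he
    have hq := mem_chart_source E q
    generalize chartAt E q = e at he hd hq
    obtain ⟨x, hx, rfl⟩ : ∃ x ∈ e.target, e.symm x = q := ⟨e q, e.map_source hq, e.left_inv hq⟩
    obtain ⟨a, rfl⟩ := hd.symm.mfderiv_surjective (x := x) hx a
    obtain ⟨b, rfl⟩ := hd.symm.mfderiv_surjective (x := x) hx b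
    exact (key e he x hx a b).1 (H e he x hx a b)

theorem contDiffOn_funInChart {f : Q → ℝ} (hf : ContMDiff 𝓘(ℝ, E) 𝓘(ℝ, ℝ) ∞ f)
    (he : e ∈ smoothCharts E Q) : ContDiffOn ℝ ∞ (funInChart f e) e.target :=
  contMDiffOn_iff_contDiffOn.1 (hf.comp_contMDiffOn (contMDiffOn_symm_of_mem_maximalAtlas he))

end TangentGeometry

end

theorem theorem1 {E : Type*} [NormedAddCommGroup E] [NormedSpace ℝ E] [FiniteDimensional ℝ E]
    {Q : Type*} [TopologicalSpace Q] [ChartedSpace E Q] [IsManifold 𝓘(ℝ, E) ∞ Q]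
    (g : TangentGeometry.PseudoMetric E Q) (J : TangentGeometry.EndoField E Q)
    (f : Q → ℝ) (hf : ContMDiff 𝓘(ℝ, E) 𝓘(ℝ, ℝ) ∞ f) :
    (TangentGeometry.GaugedInvariance g J f ↔
      TangentGeometry.IsSymmetric g J ∧ TangentGeometry.DynamicalKillingCondition g J f) ∧
    (TangentGeometry.IsSymmetric g J ∧ TangentGeometry.DynamicalKillingCondition g J f ↔
      TangentGeometry.IsSpecialConformalKilling g J f) ∧
    (TangentGeometry.GaugedInvariance g J f →
      TangentGeometry.UFormula g J f ∧
      TangentGeometry.JacobiCommutatorFormula g J f ∧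
      TangentGeometry.RFormula g J f) := by
  open TangentGeometry in
  have hg := fun e (he : e ∈ smoothCharts E Q) => g.isLocalMetric he
  have hφ := fun e (he : e ∈ smoothCharts E Q) => contDiffOn_funInChart hf he
  have hgauge : GaugedInvariance g J f ↔ ∀ e ∈ smoothCharts E Q, ∀ p : E × E, p.1 ∈ e.target →
      extD (gaugeForm (kinetic (formInChart g.val e)) (tensorInChart J.val e)
        (funInChart f e)) p = 0 :=
    ⟨fun H e he p hp => ((hg e he).gaugedInvariance_iff (J.smooth e he) (hφ e he) hp).1
      fun ξ => H e he p.1 hp p.2 ξ,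
    fun H e he x hx u ξ => ((hg e he).gaugedInvariance_iff (J.smooth e he) (hφ e he)
      (p := (x, u)) hx).2 (H e he _ hx) ξ⟩
  have hdyn : DynamicalKillingCondition g J f ↔ ∀ e ∈ smoothCharts E Q, ∀ x ∈ e.target,
      SCKAt (formInChart g.val e) (tensorInChart J.val e) (funInChart f e) x := by
    refine forall₄_congr fun e he x hx => ?_
    rw [(hg e he).sckAt_iff (hφ e he) hx]
    refine forall₂_congr fun u X => ?_
    have hp : ((x, u) : E × E).1 ∈ e.target := hx
    simp only [PseudoMetric.lagrangian, (hg e he).dynCovTensor_eq (J.smooth e he) hp,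
      (hg e he).dH_apply (hφ e he) hp, (hg e he).theta_apply hp, totalT]
  have hsck : IsSpecialConformalKilling g J f ↔
      IsSymmetric g J ∧ DynamicalKillingCondition g J f := by
    rw [hdyn]
    refine and_congr_right fun _ => forall₄_congr fun e he x hx => forall₃_congr fun c a b => ?_
    simp only [(hg e he).covDerivForm_lowered (J.smooth e he) hx]
  have hab : GaugedInvariance g J f ↔ IsSymmetric g J ∧ DynamicalKillingCondition g J f := by
    rw [hgauge, hdyn, isSymmetric_iff]
    constructor
    · intro H
      exact ⟨fun e he x hx => (hg e he).isSymmetric_of_gauge (J.smooth e he) (hφ e he) hx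
          (H e he _ hx),
        fun e he x hx => (hg e he).sckAt_of_gauge (J.smooth e he) (hφ e he) (H e he) hx⟩
    · rintro ⟨hs, hK⟩ e he p hp
      exact (hg e he).gauge_of_sckAt (J.smooth e he) (hφ e he) (hs e he) (hK e he) hp
  refine ⟨hab, hsck.symm, fun H => ?_⟩
  obtain ⟨hs, hK⟩ := hab.1 H
  rw [isSymmetric_iff] at hs
  rw [hdyn] at hK
  refine ⟨fun e he x hx u X => ?_, fun e he x hx u X => ?_, fun e he x hx u ξ => ?_⟩
  all_goals have hp : ((x, u) : E × E).1 ∈ e.target := hx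
  · simp only [PseudoMetric.lagrangian, (hg e he).uTensor_eq (J.smooth e he) (hφ e he) hp
      (hK e he x hx), (hg e he).dH_apply (hφ e he) hp, (hg e he).theta_apply hp, totalT]
  · simp only [PseudoMetric.lagrangian, (hg e he).theta_apply hp, totalT]
    exact (hg e he).jacobiEndo_commutator (J.smooth e he) (hφ e he) (hs e he) (hK e he) hp X
  · rw [PseudoMetric.lagrangian, (hg e he).recursionTensor_eq (J.smooth e he) (hs e he) hp
      (hK e he x hx), fderiv_base ((hφ e he).contDiffAt (e.open_target.mem_nhds hx)).diff]
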